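/- For a sequence $\bar p=(p_1,p_2,\dots)$ of reals in $[0,1]$ let $M^n_{\bar p}$ be the random graph on $[n]=\{1,\dots,n\}$ in which, independently for distinct pairs, $\{i,j\}$ ($i\ne j$) is an edge with probability $p_{|i-j|}$. Say that $M^n_{\bar p}$ satisfies the 0-1 law if for every first-order sentence $\psi$ in the language of graphs (adjacency and equality) the limit $\lim_{n\to\infty}\Pr[M^n_{\bar p}\models\psi]$ exists and is $0$ or $1$. Define - $Gen_1(\bar p)$: all $\bar q$ obtained from $\bar p$ by inserting zeros, i.e. such that for some strictly increasing map $f$ from the positive integers to the positive integers, $q_{f(i)}=p_i$ for all $i>0$ and $q_l=0$ for every $l>0$ not in the image of $f$; - $Gen_2(\bar p)=\{\bar q: q_l\in[0,p_l]\text{ for all }l>0\}$; - $Gen_3(\bar p)=\{\bar q: q_l\in\{0,p_l\}\text{ for all }l>0\}$. For $j\in\{1,2,3\}$ the $j$-hereditary 0-1 law holds for $\bar p$ if $M^n_{\bar q}$ satisfies the 0-1 law for every $\bar q\in Gen_j(\bar p)$. **Theorem.** Let $\bar p=(p_1,p_2,\dots)$ be a sequence of reals in $[0,1]$ such that $U^*(\bar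 p):=\{l>0:p_l=1\}$ is finite and nonempty. Then: 1. The 2-hereditary 0-1 law holds for $\bar p$ if and only if $|\{l>0:p_l>0\}|\le 1$. 2. The 3-hereditary 0-1 law holds for $\bar p$ if and only if $\{l>0:0<p_l<1\}=\emptyset$. 3. If moreover $|U^*(\bar p)|>1$, then the 1-hereditary 0-1 law holds for $\bar p$ if and only if $\{l>0:0<p_l<1\}=\emptyset$. -/

import Mathlib

open Filter Topology MeasureTheory ProbabilityTheory

/-- A sequence `(p₁, p₂, p₃, …)` of probabilities, indexed by the positive integers. -/
abbrev ProbSeq : Type := ℕ+ → unitInterval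

/-- The pairs `i < j` of vertices of `[n]`; the vertex set is modelled by `Fin n`, which is
`{1, …, n}` translated by one, so that distances between vertices do not change. -/
abbrev VertexPair (n : ℕ) : Type := {e : Fin n × Fin n // e.1 < e.2}

/-- The distance `j - i` of a pair of vertices `i < j`. -/
def VertexPair.dist {n : ℕ} (e : VertexPair n) : ℕ+ :=
  ⟨(e.1.2 : ℕ) - (e.1.1 : ℕ), Nat.sub_pos_of_lt e.2⟩

/-- The graph on `[n]` whose edges are the pairs `i < j` at which `ω` is `true`. -/
def graphOfPairs {n : ℕ} (ω : VertexPair n → Bool) : SimpleGraph (Fin n) where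
  Adj i j := (∃ h : i < j, ω ⟨(i, j), h⟩ = true) ∨ (∃ h : j < i, ω ⟨(j, i), h⟩ = true)
  symm := ⟨fun _ _ h => h.symm⟩
  loopless := ⟨fun i h => h.elim (fun ⟨h, _⟩ => lt_irrefl i h) (fun ⟨h, _⟩ => lt_irrefl i h)⟩

/-- Independent coin tosses for the pairs of vertices of `[n]`: the pair `i < j` gets the value
`true` with probability `p_{j - i}` and `false` otherwise. -/
noncomputable def pairMeasure (p : ProbSeq) (n : ℕ) : Measure (VertexPair n → Bool) :=
  Measure.pi fun e => bernoulliMeasure true false (p e.dist)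

/-- The law of the random graph `M^n_p`: a probability measure on the graphs on `[n]`, under which
`{i, j}` is an edge with probability `p_{|i - j|}`, independently for distinct pairs. -/
noncomputable def randomGraph (p : ProbSeq) (n : ℕ) : Measure (SimpleGraph (Fin n)) :=
  (pairMeasure p n).map graphOfPairs

lemma measurable_graphOfPairs {n : ℕ} :
    Measurable (graphOfPairs : (VertexPair n → Bool) → SimpleGraph (Fin n)) :=
  measurable_of_countable _

instance instIsProbabilityMeasurePairMeasure (p : ProbSeq) (n : ℕ) :
    IsProbabilityMeasure (pairMeasure p n) := by
  unfold pairMeasure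
  infer_instance

instance instIsProbabilityMeasureRandomGraph (p : ProbSeq) (n : ℕ) :
    IsProbabilityMeasure (randomGraph p n) :=
  Measure.isProbabilityMeasure_map measurable_graphOfPairs.aemeasurable

/-- The graph `G` satisfies the first-order sentence `φ` in the language of graphs
(adjacency and equality). -/
def GraphSatisfies {V : Type} (G : SimpleGraph V) (φ : FirstOrder.Language.graph.Sentence) : Prop :=
  @FirstOrder.Language.Sentence.Realize FirstOrder.Language.graph V G.structure φ

/-- `Pr[M^n_p ⊨ φ]`. -/
noncomputable def satProb (p : ProbSeq) (φ : FirstOrder.Language.graph.Sentence) (n : ℕ) : ℝ :=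
  (randomGraph p n).real {G | GraphSatisfies G φ}

/-- The 0-1 law for first-order logic in `M^n_p`: for every first-order sentence the probability
that it holds in `M^n_p` has a limit as `n → ∞`, and the limit is `0` or `1`. -/
def ZeroOneLaw (p : ProbSeq) : Prop :=
  ∀ φ : FirstOrder.Language.graph.Sentence,
    Tendsto (satProb p φ) atTop (𝓝 0) ∨ Tendsto (satProb p φ) atTop (𝓝 1)

/-- The sequences obtained from `p` by inserting zeros. -/
def Gen1 (p : ProbSeq) : Set ProbSeq :=
  {q | ∃ f : ℕ+ → ℕ+, StrictMono f ∧ (∀ i, q (f i) = p i) ∧ ∀ l, l ∉ Set.range f → q l = 0}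

/-- The sequences obtained from `p` by decreasing members of `p`. -/
def Gen2 (p : ProbSeq) : Set ProbSeq :=
  {q | ∀ l, q l ≤ p l}

/-- The sequences obtained from `p` by replacing members of `p` by zero. -/
def Gen3 (p : ProbSeq) : Set ProbSeq :=
  {q | ∀ l, q l = 0 ∨ q l = p l}

/-- `p` satisfies the 0-1 law hereditarily with respect to the operation `Gen`; for
`Gen = Gen1, Gen2, Gen3` this is the `1`-, `2`-, `3`-hereditary 0-1 law. -/
def HereditaryZeroOneLaw (Gen : ProbSeq → Set ProbSeq) (p : ProbSeq) : Prop :=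
  ∀ q ∈ Gen p, ZeroOneLaw q

/-- The set `U*(p)` of all `l > 0` with `p_l = 1`. -/
def oneSet (p : ProbSeq) : Set ℕ+ :=
  {l | p l = 1}

/-!
The 0-1 law fails as soon as some sentence has, for infinitely many `n`, a probability bounded away
from `0` and `1` (`not_zeroOneLaw_of_frequently`). In the sequences used here one distance, at
least, always gives an edge, so that the vertices near the two ends of `[n]` look different from
all others, and a sentence can speak about them. If the sentence depends on boundedly many coins
near the ends only, and these do not determine it in advance, then its probability is bounded away
from `0` and `1`.

* If `q a = 1`, `0 < q b < 1` and `q` vanishes elsewhere, all vertices but the first and last `a`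
  have degree at least two, and the sentence is "some vertex has degree at most one"
  (`not_zeroOneLaw_of_two_distances`). This refutes the 2- and the 3-hereditary law.
* Inserting zeros cannot remove the other members of `p`, of which infinitely many may be positive.
  If `p u = p v = 1`, `u < v`, zeros are inserted such that `u` and `v` are moved to distances `A`
  and `2 * A` and no other two distances, equal or not, add up to a third (`spread`). The triangles
  of the graph then consist of edges of lengths `A`, `A` and `2 * A`, which are always present, so
  that their sides determine, by first-order formulas, the set of the first and last `A` vertices
  (`isEnd_iff`) and a larger neighbourhood of the two ends that contains all neighbours of the
  first vertex at distances below `3 * A` (`nearEnd_of_lt`, `lt_of_nearEnd`). The sentence says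
  that some end vertex has in this neighbourhood no more neighbours than the number of distances
  that always give an edge (`not_zeroOneLaw_of_spread`).

The 0-1 law is proved in two cases, both with Ehrenfeucht–Fraïssé games: it suffices that with
probability tending to `1` the graphs are such that on any two of them the second player survives
`r` rounds (`zeroOneLaw_of_backAndForth`). If nothing is random and there are finitely many
distances (`zeroOneLaw_of_finite`), the second player preserves the small differences between the
chosen vertices, and those to the two ends. If there is a single distance `l` and its edges are
random (`zeroOneLaw_of_single`), the graph is a disjoint union of paths. The second player
preserves the positions of the chosen vertices on these paths as far as they can be seen locally,
which is possible as soon as all local types occur often (`Rich`); this has probability tending to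
`1`, because disjoint blocks of coins are independent.
-/

/-! ### Probabilities of sentences -/

/-- All sets of graphs on `[n]` are measurable. -/
lemma measurableSet_simpleGraph {n : ℕ} (s : Set (SimpleGraph (Fin n))) : MeasurableSet s := by
  have h : ∀ G : SimpleGraph (Fin n), MeasurableSet ({G} : Set (SimpleGraph (Fin n))) := fun G =>
    ⟨{G.Adj}, measurableSet_singleton _, by ext H; exact SimpleGraph.adj_inj⟩
  rw [← Set.biUnion_of_singleton s]
  exact s.toFinite.measurableSet_biUnion fun G _ => h G

lemma satProb_eq (q : ProbSeq) (φ : FirstOrder.Language.graph.Sentence) (n : ℕ) :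
    satProb q φ n = (pairMeasure q n).real {ω | GraphSatisfies (graphOfPairs ω) φ} := by
  rw [satProb, randomGraph, measureReal_def,
    Measure.map_apply measurable_graphOfPairs (measurableSet_simpleGraph _)]
  rfl

lemma satProb_ge {q : ProbSeq} {φ : FirstOrder.Language.graph.Sentence} {n : ℕ}
    {S : Set (VertexPair n → Bool)} (h : ∀ ω ∈ S, GraphSatisfies (graphOfPairs ω) φ) :
    (pairMeasure q n).real S ≤ satProb q φ n := by
  rw [satProb_eq]
  exact measureReal_mono h

lemma satProb_le {q : ProbSeq} {φ : FirstOrder.Language.graph.Sentence} {n : ℕ}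
    {S : Set (VertexPair n → Bool)} (h : ∀ ω ∈ S, ¬ GraphSatisfies (graphOfPairs ω) φ) :
    satProb q φ n ≤ 1 - (pairMeasure q n).real S := by
  rw [satProb_eq, ← probReal_compl_eq_one_sub S.toFinite.measurableSet]
  exact measureReal_mono fun ω hω hS => h ω hS hω

/-- A lower bound for the probability of a box: only the coins in `S` contribute. -/
lemma pow_le_pairMeasure_pi {q : ProbSeq} {n K : ℕ} {δ : ℝ} (hδ₀ : 0 ≤ δ) (hδ₁ : δ ≤ 1)
    (A : VertexPair n → Set Bool) (S : Finset (VertexPair n)) (hS : S.card ≤ K)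
    (h₁ : ∀ e ∉ S, (bernoulliMeasure true false (q e.dist)).real (A e) = 1)
    (h₂ : ∀ e ∈ S, δ ≤ (bernoulliMeasure true false (q e.dist)).real (A e)) :
    δ ^ K ≤ (pairMeasure q n).real (Set.univ.pi A) := by
  classical
  rw [pairMeasure, measureReal_def, Measure.pi_pi, ENNReal.toReal_prod]
  change _ ≤ ∏ e, (bernoulliMeasure true false (q e.dist)).real (A e)
  rw [← Finset.prod_subset S.subset_univ fun e _ he => h₁ e he]
  calc δ ^ K ≤ δ ^ S.card := pow_le_pow_of_le_one hδ₀ hδ₁ hS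
    _ = ∏ e ∈ S, δ := by simp
    _ ≤ _ := Finset.prod_le_prod (fun _ _ => hδ₀) h₂

/-- The outcomes that are compatible with the coins of probability `0` and `1` and take the values
`v` on `S` form a set of probability at least `δ ^ K`, if `S` has at most `K` members and the coins
in `S` take either value with probability at least `δ`. -/
lemma pow_le_pairMeasure_prescribed {q : ProbSeq} {n K : ℕ} {δ : ℝ} (hδ₀ : 0 ≤ δ) (hδ₁ : δ ≤ 1)
    (S : Finset (VertexPair n)) (hS : S.card ≤ K) (v : VertexPair n → Bool)
    (h : ∀ e ∈ S, 0 < q e.dist ∧ q e.dist < 1 ∧ δ ≤ q e.dist ∧ δ ≤ 1 - q e.dist) :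
    δ ^ K ≤ (pairMeasure q n).real {ω | (∀ e, q e.dist = 1 → ω e = true) ∧
      (∀ e, q e.dist = 0 → ω e = false) ∧ ∀ e ∈ S, ω e = v e} := by
  have key := pow_le_pairMeasure_pi (q := q) hδ₀ hδ₁
    (fun e => {b | (q e.dist = 1 → b = true) ∧ (q e.dist = 0 → b = false) ∧ (e ∈ S → b = v e)})
    S hS ?_ ?_
  · refine key.trans (measureReal_mono ?_)
    intro ω hω
    simp only [Set.mem_pi, Set.mem_univ, true_imp_iff, Set.mem_ofPred_eq] at hω ⊢
    exact ⟨fun e => (hω e).1, fun e => (hω e).2.1, fun e => (hω e).2.2⟩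
  · intro e he
    simp only [he, false_imp_iff, and_true]
    by_cases h1 : q e.dist = 1
    · simp [h1, measureReal_def]
    · by_cases h0 : q e.dist = 0
      · simp [h0, measureReal_def]
      · simp [h0, h1]
  · intro e he
    obtain ⟨h0, h1, h2, h3⟩ := h e he
    simp only [h0.ne', h1.ne, he, false_imp_iff, true_and, true_imp_iff]
    cases v e
    · rw [bernoulliMeasure_real_apply_of_notMem_of_mem _ (Set.toFinite _).measurableSet] <;>
        simp [h3]
    · rw [bernoulliMeasure_real_apply_of_mem_of_notMem _ (Set.toFinite _).measurableSet] <;>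
        simp [h2]

/-- A sentence whose probability is infinitely often bounded away from `0` and `1` refutes the
0-1 law. -/
lemma not_zeroOneLaw_of_frequently {q : ProbSeq} (φ : FirstOrder.Language.graph.Sentence) {δ : ℝ}
    (hδ : 0 < δ) (h : ∃ᶠ n in atTop, δ ≤ satProb q φ n ∧ satProb q φ n ≤ 1 - δ) :
    ¬ ZeroOneLaw q := by
  intro hq
  rcases hq φ with h0 | h1
  · obtain ⟨n, hn, hn'⟩ := (h.and_eventually (h0.eventually (gt_mem_nhds hδ))).exists
    linarith [hn.1]
  · obtain ⟨n, hn, hn'⟩ :=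
      (h.and_eventually (h1.eventually (lt_mem_nhds (sub_lt_self 1 hδ)))).exists
    linarith [hn.2]

lemma graphOfPairs_adj_of_lt {n : ℕ} {ω : VertexPair n → Bool} {i j : Fin n} (h : i < j) :
    (graphOfPairs ω).Adj i j ↔ ω ⟨(i, j), h⟩ = true := by
  simp [graphOfPairs, h, h.not_gt]

/-! ### Properties of graphs that first-order formulas express -/

/-- A property of graphs with marked vertices, the marks indexed by `α`, is expressible if a single
first-order formula with free variables in `α` defines it in all graphs. -/
def Expressible {α : Type} (P : ∀ V : Type, SimpleGraph V → (α → V) → Prop) : Prop :=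
  ∃ φ : FirstOrder.Language.graph.Formula α, ∀ (V : Type) (G : SimpleGraph V) (v : α → V),
    @FirstOrder.Language.Formula.Realize _ V G.structure α φ v ↔ P V G v

namespace Expressible

open FirstOrder FirstOrder.Language

variable {α : Type} {P Q : ∀ V : Type, SimpleGraph V → (α → V) → Prop}

lemma adj (x y : α) : Expressible fun _ G v => G.Adj (v x) (v y) := by
  refine ⟨(Language.adj.boundedFormula₂ (Term.var (Sum.inl x)) (Term.var (Sum.inl y)) :
    Language.graph.BoundedFormula α 0), fun V G v => ?_⟩
  let := G.structure
  rw [Formula.Realize, BoundedFormula.realize_rel₂]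
  rfl

lemma eq (x y : α) : Expressible fun _ _ v => v x = v y := by
  refine ⟨Term.equal (Term.var x) (Term.var y), fun V G v => ?_⟩
  let := G.structure
  simp

lemma not (hP : Expressible P) : Expressible fun V G v => ¬ P V G v := by
  obtain ⟨φ, hφ⟩ := hP
  refine ⟨∼φ, fun V G v => ?_⟩
  let := G.structure
  beta_reduce
  rw [← hφ V G v]
  exact Formula.realize_not

lemma and (hP : Expressible P) (hQ : Expressible Q) :
    Expressible fun V G v => P V G v ∧ Q V G v := by
  obtain ⟨φ, hφ⟩ := hP
  obtain ⟨ψ, hψ⟩ := hQ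
  refine ⟨φ ⊓ ψ, fun V G v => ?_⟩
  let := G.structure
  beta_reduce
  rw [← hφ V G v, ← hψ V G v]
  exact BoundedFormula.realize_inf

lemma or (hP : Expressible P) (hQ : Expressible Q) :
    Expressible fun V G v => P V G v ∨ Q V G v := by
  simpa only [not_and_or, not_not] using (hP.not.and hQ.not).not

lemma imp (hP : Expressible P) (hQ : Expressible Q) :
    Expressible fun V G v => P V G v → Q V G v := by
  simpa only [imp_iff_not_or] using hP.not.or hQ

lemma existsTuple {ι : Type} [Finite ι]
    {P : ∀ V : Type, SimpleGraph V → (α → V) → (ι → V) → Prop}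
    (hP : Expressible fun (V : Type) G (w : α ⊕ ι → V) =>
      P V G (fun i => w (Sum.inl i)) fun i => w (Sum.inr i)) :
    Expressible fun V G v => ∃ y : ι → V, P V G v y := by
  obtain ⟨φ, hφ⟩ := hP
  refine ⟨φ.iExs ι, fun V G v => ?_⟩
  let := G.structure
  rw [Formula.realize_iExs]
  exact exists_congr fun y => hφ V G (Sum.elim v y)

lemma exists' {P : ∀ V : Type, SimpleGraph V → (α → V) → V → Prop}
    (hP : Expressible fun (V : Type) G (w : α ⊕ Unit → V) =>
      P V G (fun i => w (Sum.inl i)) (w (Sum.inr ()))) :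
    Expressible fun V G v => ∃ y : V, P V G v y := by
  have h := existsTuple (ι := Unit) (P := fun V G v y => P V G v (y ())) hP
  have e : (fun (V : Type) (G : SimpleGraph V) (v : α → V) => ∃ y : V, P V G v y) =
      fun V G v => ∃ y : Unit → V, P V G v (y ()) := by
    funext V G v
    exact propext ⟨fun ⟨y, hy⟩ => ⟨fun _ => y, hy⟩, fun ⟨y, hy⟩ => ⟨y (), hy⟩⟩
  rwa [e]

lemma forall' {P : ∀ V : Type, SimpleGraph V → (α → V) → V → Prop}
    (hP : Expressible fun (V : Type) G (w : α ⊕ Unit → V) =>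
      P V G (fun i => w (Sum.inl i)) (w (Sum.inr ()))) :
    Expressible fun V G v => ∀ y : V, P V G v y := by
  simpa only [not_exists, not_not] using
    (exists' (P := fun V G v y => ¬ P V G v y) hP.not).not

lemma existsIndex {ι : Type} [Finite ι] {P : ι → ∀ V : Type, SimpleGraph V → (α → V) → Prop}
    (hP : ∀ i, Expressible (P i)) : Expressible fun V G v => ∃ i, P i V G v := by
  choose φ hφ using hP
  refine ⟨Formula.iSup φ, fun V G v => ?_⟩
  let := G.structure
  rw [Formula.realize_iSup]
  exact exists_congr fun i => hφ i V G v

end Expressible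

/-- At most `s` elements of `V` satisfy `P`, in the form in which a first-order formula says so (the
list `y` may have repetitions; for `V` empty and `s` positive there is no such list). -/
def AtMost {V : Type} (s : ℕ) (P : V → Prop) : Prop :=
  ∃ y : Fin s → V, ∀ z, P z → ∃ i, z = y i

lemma Expressible.atMost {α : Type} (s : ℕ) {P : ∀ V : Type, SimpleGraph V → (α → V) → V → Prop}
    (hP : Expressible fun (V : Type) G (w : (α ⊕ Fin s) ⊕ Unit → V) =>
      P V G (fun i => w (Sum.inl (Sum.inl i))) (w (Sum.inr ()))) :
    Expressible fun V G v => AtMost s fun z => P V G v z :=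
  existsTuple <| forall' <| hP.imp <| existsIndex fun _ => eq _ _

lemma AtMost.card_le {V : Type} {s : ℕ} {P : V → Prop} (h : AtMost s P) (S : Finset V)
    (hS : ∀ z ∈ S, P z) : S.card ≤ s := by
  classical
  obtain ⟨y, hy⟩ := h
  have hsub : S ⊆ Finset.univ.image y := fun z hz => by
    obtain ⟨i, rfl⟩ := hy z (hS z hz)
    exact Finset.mem_image_of_mem _ (Finset.mem_univ i)
  simpa using (Finset.card_le_card hsub).trans Finset.card_image_le

lemma atMost_of_finset {V : Type} [Nonempty V] {s : ℕ} {P : V → Prop} (S : Finset V)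
    (hS : S.card ≤ s) (h : ∀ z, P z → z ∈ S) : AtMost s P := by
  classical
  refine ⟨fun i => if hi : (i : ℕ) < S.card then (S.equivFin.symm ⟨i, hi⟩ : V)
    else Classical.arbitrary V, fun z hz => ?_⟩
  have hc := (S.equivFin ⟨z, h z hz⟩).2
  refine ⟨⟨S.equivFin ⟨z, h z hz⟩, hc.trans_le hS⟩, ?_⟩
  simp [hc]

/-- An expressible property without marked vertices is defined by a sentence. -/
lemma Expressible.exists_sentence {P : ∀ V : Type, SimpleGraph V → Prop}
    (hP : Expressible (α := Empty) fun V G _ => P V G) :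
    ∃ φ : FirstOrder.Language.graph.Sentence,
      ∀ (V : Type) (G : SimpleGraph V), GraphSatisfies G φ ↔ P V G := by
  obtain ⟨φ, hφ⟩ := hP
  exact ⟨φ, fun V G => hφ V G _⟩

/-! ### Two distances, one of them random -/

lemma VertexPair.dist_eq_iff {n : ℕ} (e : VertexPair n) (d : ℕ+) :
    e.dist = d ↔ (e.1.2 : ℕ) = e.1.1 + d := by
  have h : (e.1.1 : ℕ) < e.1.2 := e.2
  rw [← PNat.coe_inj]
  change (e.1.2 : ℕ) - (e.1.1 : ℕ) = d ↔ _
  omega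

section Sure

variable {q : ProbSeq} {n : ℕ} {ω : VertexPair n → Bool} {i j : Fin n} {d : ℕ+}

lemma graphOfPairs_adj_of_coin (h : ∀ e : VertexPair n, e.1.1 = i → e.dist = d → ω e = true)
    (hij : (j : ℕ) = i + d) : (graphOfPairs ω).Adj i j := by
  have hlt : i < j := by
    rw [Fin.lt_def, hij]
    exact Nat.lt_add_of_pos_right d.pos
  rw [graphOfPairs_adj_of_lt hlt]
  exact h _ rfl ((VertexPair.dist_eq_iff _ _).2 hij)

lemma graphOfPairs_adj_of_eq_one (h₁ : ∀ e : VertexPair n, q e.dist = 1 → ω e = true)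
    (hd : q d = 1) (hij : (j : ℕ) = i + d) : (graphOfPairs ω).Adj i j :=
  graphOfPairs_adj_of_coin (fun e _ he => h₁ e (he ▸ hd)) hij

lemma exists_coin_of_adj_of_lt (h₀ : ∀ e : VertexPair n, q e.dist = 0 → ω e = false)
    (h : (graphOfPairs ω).Adj i j) (hij : i < j) :
    ∃ d : ℕ+, q d ≠ 0 ∧ (j : ℕ) = i + d ∧
      ∃ e : VertexPair n, e.1 = (i, j) ∧ e.dist = d ∧ ω e = true := by
  rw [graphOfPairs_adj_of_lt hij] at h
  refine ⟨VertexPair.dist ⟨(i, j), hij⟩, fun hd => ?_,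
    (VertexPair.dist_eq_iff ⟨(i, j), hij⟩ _).1 rfl, _, rfl, rfl, h⟩
  simp [h₀ _ hd] at h

lemma exists_dist_of_adj (h₀ : ∀ e : VertexPair n, q e.dist = 0 → ω e = false)
    (h : (graphOfPairs ω).Adj i j) :
    ∃ d : ℕ+, q d ≠ 0 ∧ ((j : ℕ) = i + d ∨ (i : ℕ) = j + d) := by
  rcases lt_or_gt_of_ne h.ne with hij | hij
  · obtain ⟨d, hd, hd', -⟩ := exists_coin_of_adj_of_lt h₀ h hij
    exact ⟨d, hd, Or.inl hd'⟩
  · obtain ⟨d, hd, hd', -⟩ := exists_coin_of_adj_of_lt h₀ h.symm hij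
    exact ⟨d, hd, Or.inr hd'⟩

end Sure

/-- The pairs of vertices of `[n]` at distance `d` that have their left member among the first `a`
vertices or their right member among the last `a`. -/
def endPairs (n a : ℕ) (d : ℕ+) : Finset (VertexPair n) :=
  Finset.univ.filter fun e => e.dist = d ∧ ((e.1.1 : ℕ) < a ∨ n ≤ e.1.2 + a)

lemma card_endPairs_le (n a : ℕ) (d : ℕ+) : (endPairs n a d).card ≤ 2 * a := by
  rw [← Finset.card_range (2 * a)]
  refine Finset.card_le_card_of_injOn
    (fun e => if (e.1.1 : ℕ) < a then (e.1.1 : ℕ) else a + (n - 1 - e.1.2)) ?_ ?_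
  · intro e he
    simp only [endPairs, Finset.coe_filter, Finset.mem_univ, true_and, Set.mem_ofPred_eq] at he
    have := e.1.2.isLt
    simp only [Finset.coe_range, Set.mem_Iio]
    split_ifs <;> omega
  · intro e he e' he' h
    simp only [endPairs, Finset.coe_filter, Finset.mem_univ, true_and, Set.mem_ofPred_eq,
      VertexPair.dist_eq_iff] at he he'
    have h1 := e.1.2.isLt
    have h2 := e'.1.2.isLt
    have : (e.1.1 : ℕ) = e'.1.1 ∧ (e.1.2 : ℕ) = e'.1.2 := by
      dsimp only at h
      split_ifs at h <;> omega
    exact Subtype.ext (Prod.ext (Fin.ext this.1) (Fin.ext this.2))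

/-- With one distance that always gives an edge, one that gives an edge at random and no other, the
probability that some vertex has degree at most one tends neither to `0` nor to `1`: all vertices
but boundedly many at the two ends have degree at least two, and the ends are decided by boundedly
many coins. -/
theorem not_zeroOneLaw_of_two_distances {q : ProbSeq} {a b : ℕ+} (ha : q a = 1) (hb₀ : 0 < q b)
    (hb₁ : q b < 1) (h : ∀ l, l ≠ a → l ≠ b → q l = 0) : ¬ ZeroOneLaw q := by
  have hab : a ≠ b := fun hab => by simp [← hab, ha] at hb₁
  have hab' : (a : ℕ) ≠ b := fun h => hab (PNat.coe_inj.1 h)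
  obtain ⟨φ, hφ⟩ := Expressible.exists_sentence (P := fun V G => ∃ x, AtMost 1 fun z => G.Adj x z)
    (Expressible.exists' (Expressible.atMost 1 (Expressible.adj _ _)))
  set δ : ℝ := min (q b : ℝ) (1 - q b)
  have hb₁' : (q b : ℝ) < 1 := hb₁
  have hδ : 0 < δ := lt_min hb₀ (by linarith)
  have hδ₁ : δ ≤ 1 := (min_le_left _ _).trans hb₁'.le
  have hcoin : ∀ l, l = b → 0 < q l ∧ q l < 1 ∧ δ ≤ q l ∧ δ ≤ 1 - q l := fun l hl =>
    hl ▸ ⟨hb₀, hb₁, min_le_left _ _, min_le_right _ _⟩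
  refine not_zeroOneLaw_of_frequently φ (pow_pos hδ (2 * a)) (Eventually.frequently ?_)
  filter_upwards [eventually_ge_atTop (2 * a + 2 * b + 1 : ℕ)] with n hn
  have hapos := a.pos
  have hbpos := b.pos
  constructor
  · -- If the coin at distance `b` fails at the first vertex, that vertex has degree one.
    refine (pow_le_pairMeasure_prescribed hδ.le hδ₁
      (Finset.univ.filter fun e => e.dist = b ∧ (e.1.1 : ℕ) = 0) ?_ (fun _ => false)
      fun e he => hcoin _ (Finset.mem_filter.1 he).2.1).trans
      (satProb_ge ?_)
    · refine (Finset.card_le_card fun e he => ?_).trans (card_endPairs_le n a b)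
      simp only [endPairs, Finset.mem_filter, Finset.mem_univ, true_and] at he ⊢
      exact ⟨he.1, Or.inl (by omega)⟩
    · rintro ω ⟨-, hω₀, hω⟩
      rw [hφ]
      refine ⟨⟨0, by omega⟩, fun _ => ⟨a, by omega⟩, fun z hz => ⟨0, ?_⟩⟩
      have hlt : (⟨0, by omega⟩ : Fin n) < z :=
        lt_of_le_of_ne (Nat.zero_le _) hz.ne
      obtain ⟨d, hd, hd', e, he, he', he''⟩ := exists_coin_of_adj_of_lt hω₀ hz hlt
      have hdb : d ≠ b := by
        rintro rfl
        have := hω e (by simp [he, he'])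
        simp [this] at he''
      have hda : d = a := by
        by_contra hda
        exact hd (h d hda hdb)
      subst hda
      exact Fin.ext (by simpa using hd')
  · -- If all the coins near the two ends succeed, all vertices have two neighbours.
    refine (satProb_le ?_).trans (sub_le_sub_left (pow_le_pairMeasure_prescribed hδ.le hδ₁
      (endPairs n a b) (card_endPairs_le n a b) (fun _ => true) ?_) 1)
    · rintro ω ⟨hω₁, -, hω⟩
      rw [hφ]
      rintro ⟨x, hx⟩
      suffices ∃ y z, y ≠ z ∧ (graphOfPairs ω).Adj x y ∧ (graphOfPairs ω).Adj x z by
        obtain ⟨y, z, hyz, hy, hz⟩ := this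
        have := hx.card_le {y, z} (by simp [hy, hz])
        rw [Finset.card_pair hyz] at this
        omega
      have hxn := x.isLt
      have hr : ∀ hxa : (x : ℕ) + a < n, (graphOfPairs ω).Adj x ⟨x + a, hxa⟩ := fun hxa =>
        graphOfPairs_adj_of_eq_one hω₁ ha rfl
      have hl : ∀ hxa : (a : ℕ) ≤ x, (graphOfPairs ω).Adj x ⟨x - a, by omega⟩ := fun hxa =>
        (graphOfPairs_adj_of_eq_one hω₁ ha (by simp; omega)).symm
      by_cases h1 : (x : ℕ) < a
      · refine ⟨⟨x + a, by omega⟩, ⟨x + b, by omega⟩, by simpa using hab', hr _,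
          graphOfPairs_adj_of_coin (d := b) (fun e he hd => hω e ?_) rfl⟩
        simp [endPairs, hd, he, h1]
      by_cases h2 : n ≤ x + a
      · refine ⟨⟨x - a, by omega⟩, ⟨x - b, by omega⟩, by simp; omega, hl (by omega),
          (graphOfPairs_adj_of_coin (d := b) (fun e he hd => hω e ?_) (by simp; omega)).symm⟩
        have he' := (VertexPair.dist_eq_iff _ _).1 hd
        rw [he] at he'
        simp only [endPairs, Finset.mem_filter, Finset.mem_univ, hd, true_and]
        right
        dsimp only at he'
        omega
      · exact ⟨⟨x - a, by omega⟩, ⟨x + a, by omega⟩, by simp; omega, hl (by omega), hr _⟩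
    · intro e he
      simp only [endPairs, Finset.mem_filter] at he
      exact hcoin _ he.2.1

/-! ### Spreading out the distances -/

/-- A strictly increasing map that sends `u < v ≤ L` to `A` and `2 * A`, where `A = 4 * (L + 1)`,
and for which `spread i + spread j = spread k` has no solution other than `i = j = u`, `k = v`. Up
to `L` the values other than `A` and `2 * A` have residues modulo `A` between a quarter and a half
of `A`, all of them different; beyond `L` the values grow too fast to be sums of two earlier
ones. -/
def spread (u v L i : ℕ) : ℕ :=
  if L < i then 4 * (L + 1) * 16 ^ (i - L)
  else if i < u then L + 1 + i
  else if i = u then 4 * (L + 1)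
  else if i < v then 4 * (L + 1) + (L + 1 + i)
  else if i = v then 8 * (L + 1)
  else 8 * (L + 1) + (L + 1 + i)

section Spread

variable {u v L i j k : ℕ}

lemma spread_pos : 0 < spread u v L i := by
  unfold spread
  split_ifs <;> positivity

lemma spread_lt_of_le (h : i ≤ L) : spread u v L i < 12 * (L + 1) := by
  unfold spread
  split_ifs <;> omega

lemma le_spread_of_lt (h : L < i) : 64 * (L + 1) ≤ spread u v L i := by
  have : 16 ^ 1 ≤ 16 ^ (i - L) := Nat.pow_le_pow_right (by norm_num) (by omega)
  rw [spread, if_pos h]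
  nlinarith

lemma mul_spread_le_of_lt (hi : L < i) (h : i < k) : 16 * spread u v L i ≤ spread u v L k := by
  have : 16 ^ (i - L) * 16 ≤ 16 ^ (k - L) := by
    rw [← pow_succ]
    exact Nat.pow_le_pow_right (by norm_num) (by omega)
  rw [spread, spread, if_pos hi, if_pos (hi.trans h)]
  nlinarith

lemma two_mul_spread_lt_of_lt (hk : L < k) (h : i < k) :
    2 * spread u v L i < spread u v L k := by
  rcases le_or_gt i L with hi | hi
  · have := spread_lt_of_le (u := u) (v := v) hi
    have := le_spread_of_lt (u := u) (v := v) hk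
    omega
  · have := mul_spread_le_of_lt (u := u) (v := v) hi h
    have := spread_pos (u := u) (v := v) (L := L) (i := i)
    omega

lemma spread_strictMono (huv : u < v) : StrictMono (spread u v L) := by
  intro i k h
  rcases le_or_gt k L with hk | hk
  · unfold spread
    split_ifs <;> omega
  · have := two_mul_spread_lt_of_lt (u := u) (v := v) hk h
    omega

lemma spread_left (huv : u < v) (hvL : v ≤ L) : spread u v L u = 4 * (L + 1) := by
  rw [spread, if_neg (by omega), if_neg (by omega), if_pos rfl]

lemma spread_right (huv : u < v) (hvL : v ≤ L) : spread u v L v = 8 * (L + 1) := by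
  rw [spread, if_neg (by omega), if_neg (by omega), if_neg (by omega), if_neg (by omega),
    if_pos rfl]

lemma eq_of_spread_add_spread_eq (huv : u < v) (hvL : v ≤ L)
    (h : spread u v L i + spread u v L j = spread u v L k) :
    spread u v L i = 4 * (L + 1) ∧ spread u v L j = 4 * (L + 1) ∧
      spread u v L k = 8 * (L + 1) := by
  have hi : i < k := (spread_strictMono (L := L) huv).lt_iff_lt.1
    (h ▸ Nat.lt_add_of_pos_right spread_pos)
  have hj : j < k := (spread_strictMono (L := L) huv).lt_iff_lt.1
    (h ▸ Nat.lt_add_of_pos_left spread_pos)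
  rcases le_or_gt k L with hk | hk
  · suffices i = u ∧ j = u ∧ k = v by
      obtain ⟨rfl, rfl, rfl⟩ := this
      exact ⟨spread_left huv hvL, spread_left huv hvL, spread_right huv hvL⟩
    unfold spread at h
    simp only [if_neg (by omega : ¬ L < i), if_neg (by omega : ¬ L < j), if_neg hk.not_gt] at h
    split_ifs at h <;> omega
  · have := two_mul_spread_lt_of_lt (u := u) (v := v) hk hi
    have := two_mul_spread_lt_of_lt (u := u) (v := v) hk hj
    omega

end Spread

/-! ### The ends of the graph seen through its triangles -/

/-- Two vertices that are adjacent and have a common neighbour. -/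
def TriAdj {V : Type} (G : SimpleGraph V) (x y : V) : Prop :=
  G.Adj x y ∧ ∃ z, G.Adj x z ∧ G.Adj y z

lemma TriAdj.symm {V : Type} {G : SimpleGraph V} {x y : V} (h : TriAdj G x y) : TriAdj G y x :=
  ⟨h.1.symm, h.2.imp fun _ => And.symm⟩

/-- A vertex that shares a triangle side with at most two vertices. -/
def IsEnd {V : Type} (G : SimpleGraph V) (x : V) : Prop :=
  AtMost 2 fun y => TriAdj G x y

/-- A vertex that is reached from an end vertex along at most two sides of triangles. -/
def NearEnd {V : Type} (G : SimpleGraph V) (x : V) : Prop :=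
  ∃ y, IsEnd G y ∧ ∃ z, (y = z ∨ TriAdj G y z) ∧ (z = x ∨ TriAdj G z x)

namespace Expressible

lemma triAdj {α : Type} (x y : α) : Expressible fun _ G v => TriAdj G (v x) (v y) :=
  (adj x y).and <| exists' <| (adj _ _).and (adj _ _)

lemma isEnd {α : Type} (x : α) : Expressible fun _ G v => IsEnd G (v x) :=
  atMost 2 <| triAdj _ _

lemma nearEnd {α : Type} (x : α) : Expressible fun _ G v => NearEnd G (v x) :=
  exists' <| (isEnd _).and <| exists' <|
    ((eq _ _).or (triAdj _ _)).and ((eq _ _).or (triAdj _ _))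

end Expressible

section Triangles

/-! Graphs on `[n]` whose distances are values of a function `F` that solve `F i + F j = F k` only
as `A + A = 2 * A`, and in which the vertices at distance `A` or `2 * A` are adjacent. -/

variable {n A : ℕ} {G : SimpleGraph (Fin n)} {F : ℕ → ℕ}

lemma triAdj_iff (hA : 0 < A) (hn : 4 * A ≤ n)
    (hF : ∀ i j k, F i + F j = F k → F i = A ∧ F j = A ∧ F k = 2 * A)
    (hG : ∀ x y, G.Adj x y → ∃ i, (y : ℕ) = x + F i ∨ (x : ℕ) = y + F i)
    (hA₁ : ∀ x y : Fin n, (y : ℕ) = x + A → G.Adj x y)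
    (hA₂ : ∀ x y : Fin n, (y : ℕ) = x + 2 * A → G.Adj x y) {x y : Fin n} :
    TriAdj G x y ↔ (y : ℕ) = x + A ∨ (y : ℕ) = x + 2 * A ∨ (x : ℕ) = y + A ∨
      (x : ℕ) = y + 2 * A := by
  constructor
  · rintro ⟨hxy, z, hxz, hyz⟩
    obtain ⟨i, hi⟩ := hG _ _ hxy
    obtain ⟨j, hj⟩ := hG _ _ hxz
    obtain ⟨k, hk⟩ := hG _ _ hyz
    have h1 := hF i j k
    have h2 := hF i k j
    have h3 := hF j k i
    have : (x : ℕ) ≠ y := fun h => hxy.ne (Fin.ext h)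
    have : (x : ℕ) ≠ z := fun h => hxz.ne (Fin.ext h)
    have : (y : ℕ) ≠ z := fun h => hyz.ne (Fin.ext h)
    rcases hi with hi | hi <;> rcases hj with hj | hj <;> rcases hk with hk | hk <;> omega
  · have key : ∀ x y : Fin n, (y : ℕ) = x + A ∨ (y : ℕ) = x + 2 * A → TriAdj G x y := by
      rintro x y (h | h)
      · refine ⟨hA₁ _ _ h, ?_⟩
        by_cases hx : (x : ℕ) + 2 * A < n
        · exact ⟨⟨x + 2 * A, hx⟩, hA₂ _ _ rfl, hA₁ _ _ (by simp only; omega)⟩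
        · exact ⟨⟨x - A, by omega⟩, (hA₁ _ _ (by simp only; omega)).symm,
            (hA₂ _ _ (by simp only; omega)).symm⟩
      · exact ⟨hA₂ _ _ h, ⟨x + A, by omega⟩, hA₁ _ _ rfl, (hA₁ _ _ (by simp only; omega)).symm⟩
    rintro (h | h | h | h)
    · exact key _ _ (Or.inl h)
    · exact key _ _ (Or.inr h)
    · exact (key _ _ (Or.inl h)).symm
    · exact (key _ _ (Or.inr h)).symm

lemma isEnd_iff (hA : 0 < A) (hn : 4 * A ≤ n)
    (hT : ∀ x y, TriAdj G x y ↔ (y : ℕ) = x + A ∨ (y : ℕ) = x + 2 * A ∨ (x : ℕ) = y + A ∨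
      (x : ℕ) = y + 2 * A) (x : Fin n) :
    IsEnd G x ↔ (x : ℕ) < A ∨ n ≤ x + A := by
  have hxn := x.isLt
  constructor
  · intro h
    by_contra! hx
    obtain ⟨w, hw, hw'⟩ : ∃ w : Fin n, TriAdj G x w ∧
        ((w : ℕ) = x + 2 * A ∨ (x : ℕ) = w + 2 * A) := by
      by_cases hx : (x : ℕ) + 2 * A < n
      · exact ⟨⟨x + 2 * A, hx⟩, (hT _ _).2 (by simp), by simp⟩
      · exact ⟨⟨x - 2 * A, by omega⟩, (hT _ _).2 (by simp only; omega), by simp only; omega⟩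
    have := h.card_le {w, ⟨x + A, hx.2⟩, ⟨x - A, by omega⟩} (by
      simp only [Finset.mem_insert, Finset.mem_singleton, forall_eq_or_imp, forall_eq]
      exact ⟨hw, (hT _ _).2 (by simp), (hT _ _).2 (by simp only; omega)⟩)
    rw [Finset.card_eq_three.2 ⟨_, _, _, ?_, ?_, ?_, rfl⟩] at this
    · omega
    all_goals rw [Ne, Fin.ext_iff]; dsimp only; omega
  · rintro (hx | hx)
    · refine ⟨![⟨x + A, by omega⟩, ⟨x + 2 * A, by omega⟩], fun z hz => ?_⟩
      simp only [Fin.exists_fin_two, Fin.ext_iff, Matrix.cons_val_zero, Matrix.cons_val_one]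
      have := (hT _ _).1 hz
      omega
    · refine ⟨![⟨x - A, by omega⟩, ⟨x - 2 * A, by omega⟩], fun z hz => ?_⟩
      simp only [Fin.exists_fin_two, Fin.ext_iff, Matrix.cons_val_zero, Matrix.cons_val_one]
      have := (hT _ _).1 hz
      omega

lemma nearEnd_of_lt
    (hT : ∀ x y, TriAdj G x y ↔ (y : ℕ) = x + A ∨ (y : ℕ) = x + 2 * A ∨ (x : ℕ) = y + A ∨
      (x : ℕ) = y + 2 * A)
    (hE : ∀ x, IsEnd G x ↔ (x : ℕ) < A ∨ n ≤ x + A) {x : Fin n}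
    (hx : (x : ℕ) < 4 * A ∨ n ≤ x + 4 * A) : NearEnd G x := by
  have hxn := x.isLt
  simp only [NearEnd, hT, hE, Fin.ext_iff]
  rcases hx with hx | hx
  · rcases lt_or_ge (x : ℕ) (2 * A) with h | h
    · rcases lt_or_ge (x : ℕ) A with h' | h'
      · exact ⟨x, by omega, x, by omega, by omega⟩
      · exact ⟨⟨x - A, by omega⟩, by simp only; omega, x, by simp only; omega, by omega⟩
    · rcases lt_or_ge (x : ℕ) (3 * A) with h' | h'
      · exact ⟨⟨x - 2 * A, by omega⟩, by simp only; omega, x, by simp only; omega, by omega⟩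
      · exact ⟨⟨x - 3 * A, by omega⟩, by simp only; omega, ⟨x - A, by omega⟩, by simp only; omega,
          by simp only; omega⟩
  · rcases le_or_gt n (x + 2 * A) with h | h
    · rcases le_or_gt n (x + A) with h' | h'
      · exact ⟨x, by omega, x, by omega, by omega⟩
      · exact ⟨⟨x + A, by omega⟩, by simp only; omega, x, by simp, by omega⟩
    · rcases le_or_gt n (x + 3 * A) with h' | h'
      · exact ⟨⟨x + 2 * A, by omega⟩, by simp only; omega, x, by simp, by omega⟩
      · exact ⟨⟨x + 3 * A, by omega⟩, by simp only; omega, ⟨x + A, by omega⟩, by simp only; omega,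
          by simp⟩

lemma lt_of_nearEnd
    (hT : ∀ x y, TriAdj G x y ↔ (y : ℕ) = x + A ∨ (y : ℕ) = x + 2 * A ∨ (x : ℕ) = y + A ∨
      (x : ℕ) = y + 2 * A)
    (hE : ∀ x, IsEnd G x ↔ (x : ℕ) < A ∨ n ≤ x + A) {x : Fin n}
    (hx : NearEnd G x) : (x : ℕ) < 5 * A ∨ n ≤ x + 5 * A := by
  simp only [NearEnd, hT, hE, Fin.ext_iff] at hx
  obtain ⟨y, hy, z, hyz, hzx⟩ := hx
  have := y.isLt
  have := z.isLt
  omega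

end Triangles

/-! ### Two distances that always give an edge -/

/-- The map `spread` on the positive integers. -/
def pnatSpread (u v L i : ℕ+) : ℕ+ :=
  ⟨spread u v L i, spread_pos⟩

lemma pnatSpread_strictMono {u v L : ℕ+} (huv : u < v) : StrictMono (pnatSpread u v L) :=
  fun _ _ h => spread_strictMono (L := (L : ℕ)) (show (u : ℕ) < v from huv) h

lemma exists_pos_le_of_le (p : ProbSeq) (L : ℕ+) :
    ∃ δ : ℝ, 0 < δ ∧ δ ≤ 1 ∧ ∀ i ≤ L, 0 < p i → p i < 1 → δ ≤ p i ∧ δ ≤ 1 - p i := by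
  have h : ∀ᶠ δ : ℝ in 𝓝[>] (0 : ℝ), ∀ i ∈ Finset.Icc 1 L, 0 < p i → p i < 1 →
      δ ≤ (p i : ℝ) ∧ δ ≤ 1 - (p i : ℝ) := by
    rw [Filter.eventually_all_finset]
    intro i _
    by_cases hi : 0 < p i ∧ p i < 1
    · have h0 : (0 : ℝ) < p i := hi.1
      have h1 : (p i : ℝ) < 1 := hi.2
      filter_upwards [Ioo_mem_nhdsGT (lt_min h0 (sub_pos.2 h1))] with δ hδ _ _
      exact le_min_iff.1 hδ.2.le
    · exact Eventually.of_forall fun δ h0 h1 => absurd ⟨h0, h1⟩ hi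
  obtain ⟨δ, hδ, hδ'⟩ := (h.and (Ioo_mem_nhdsGT (zero_lt_one' ℝ))).exists
  exact ⟨δ, hδ'.1, hδ'.2.le, fun i hi => hδ i (Finset.mem_Icc.2 ⟨one_le, hi⟩)⟩

/-- If `p` takes the value `1` at two places at least and finitely often, and a value strictly
between `0` and `1` somewhere, then spreading out `p` destroys the 0-1 law. The sentence says that
some end vertex has at most `s` neighbours near the ends, where `s` is the number of places at which
`p` is `1`. For suitable arbitrarily large `n` it is decided by boundedly many coins. -/
theorem not_zeroOneLaw_of_spread {p q : ProbSeq} {u v c L : ℕ+} (hfin : (oneSet p).Finite)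
    (huv : u < v) (hu : p u = 1) (hv : p v = 1) (hc₀ : 0 < p c) (hc₁ : p c < 1) (hcL : c ≤ L)
    (hL : ∀ i, p i = 1 → i ≤ L) (hq : ∀ i, q (pnatSpread u v L i) = p i)
    (hq₀ : ∀ l, l ∉ Set.range (pnatSpread u v L) → q l = 0) : ¬ ZeroOneLaw q := by
  classical
  set U := hfin.toFinset with hU
  have hmemU : ∀ i, i ∈ U ↔ p i = 1 := fun i => by simp [hU, oneSet]
  obtain ⟨φ, hφ⟩ := Expressible.exists_sentence
    (P := fun V G => ∃ x, IsEnd G x ∧ AtMost U.card fun z => G.Adj x z ∧ NearEnd G z)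
    (Expressible.exists' <| (Expressible.isEnd _).and <| Expressible.atMost _ <|
      (Expressible.adj _ _).and (Expressible.nearEnd _))
  obtain ⟨δ, hδ, hδ₁, hδp⟩ := exists_pos_le_of_le p L
  have huv' : (u : ℕ) < v := huv
  have hvL : (v : ℕ) ≤ L := hL v hv
  set F := spread u v L with hFdef
  have hFmono : StrictMono F := spread_strictMono huv'
  set A : ℕ := 4 * (L + 1) with hA
  have hFu : F u = A := spread_left huv' hvL
  have hFv : F v = 2 * A := by rw [hA, hFdef, spread_right huv' hvL]; ring
  have hF : ∀ i j k, F i + F j = F k → F i = A ∧ F j = A ∧ F k = 2 * A := fun i j k h => by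
    have : F i = A ∧ F j = A ∧ F k = 8 * (L + 1) := eq_of_spread_add_spread_eq huv' hvL h
    omega
  have hFle : ∀ i : ℕ, i ≤ L → F i < 3 * A := fun i hi => by
    have : F i < _ := spread_lt_of_le hi
    omega
  have hFge : ∀ i : ℕ, L < i → 16 * A ≤ F i := fun i hi => by
    have : _ ≤ F i := le_spread_of_lt hi
    omega
  have hcoin : ∀ (i l : ℕ+), i ≤ L → 0 < p i → p i < 1 → l = pnatSpread u v L i →
      0 < q l ∧ q l < 1 ∧ δ ≤ q l ∧ δ ≤ 1 - q l := by
    rintro i l hi h0 h1 rfl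
    rw [hq]
    exact ⟨h0, h1, hδp i hi h0 h1⟩
  refine not_zeroOneLaw_of_frequently φ (pow_pos hδ (3 * A)) (frequently_atTop.2 fun N => ?_)
  -- No distance of the spread-out sequence lies between `n - 5 * A` and `n`, so that no edge joins
  -- the first vertex to the last `5 * A` vertices.
  set k : ℕ := N + L + 1 with hk
  set n : ℕ := 8 * F k with hn
  have hFk := hFge k (by omega)
  have hgap : ∀ i : ℕ, F i < n → F i + 5 * A < n := fun i hi => by
    rcases le_or_gt i k with h | h
    · have := hFmono.monotone h
      omega
    · have : 16 * F k ≤ F i := mul_spread_le_of_lt (by omega) h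
      omega
  refine ⟨n, ?_, ?_⟩
  · have := hFmono.le_apply (x := k)
    omega
  have hstruct : ∀ ω : VertexPair n → Bool, (∀ e, q e.dist = 1 → ω e = true) →
      (∀ e, q e.dist = 0 → ω e = false) →
      (∀ x, IsEnd (graphOfPairs ω) x ↔ (x : ℕ) < A ∨ n ≤ x + A) ∧
      (∀ x : Fin n, ((x : ℕ) < 4 * A ∨ n ≤ x + 4 * A) → NearEnd (graphOfPairs ω) x) ∧
      (∀ x : Fin n, NearEnd (graphOfPairs ω) x → (x : ℕ) < 5 * A ∨ n ≤ x + 5 * A) := by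
    intro ω hω₁ hω₀
    have hT : ∀ x y : Fin n, TriAdj (graphOfPairs ω) x y ↔ (y : ℕ) = x + A ∨
        (y : ℕ) = x + 2 * A ∨ (x : ℕ) = y + A ∨ (x : ℕ) = y + 2 * A := fun x y => by
      refine triAdj_iff (by omega) (by omega) hF (fun x y h => ?_) (fun x y h => ?_) fun x y h => ?_
      · obtain ⟨d, hd, hd'⟩ := exists_dist_of_adj hω₀ h
        obtain ⟨i, rfl⟩ : d ∈ Set.range (pnatSpread u v L) := by
          by_contra hd''
          exact hd (hq₀ d hd'')
        exact ⟨i, hd'⟩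
      · exact graphOfPairs_adj_of_eq_one (d := pnatSpread u v L u) hω₁ (by rw [hq, hu])
          (h.trans (by rw [← hFu]; rfl))
      · exact graphOfPairs_adj_of_eq_one (d := pnatSpread u v L v) hω₁ (by rw [hq, hv])
          (h.trans (by rw [← hFv]; rfl))
    have hE := isEnd_iff (by omega) (by omega) hT
    exact ⟨hE, fun x hx => nearEnd_of_lt hT hE hx, fun x hx => lt_of_nearEnd hT hE hx⟩
  constructor
  · -- If the coins at the first vertex with distances up to `3 * A` all fail, the neighbours of
    -- that vertex near the ends are those at the distances that always give an edge.
    refine (pow_le_pairMeasure_prescribed hδ.le hδ₁ (Finset.univ.filter fun e : VertexPair n =>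
      (e.1.1 : ℕ) = 0 ∧ ∃ i ≤ L, 0 < p i ∧ p i < 1 ∧ e.dist = pnatSpread u v L i) ?_
      (fun _ => false)
      fun e he => ?_).trans (satProb_ge ?_)
    · rw [← Finset.card_range (3 * A)]
      refine Finset.card_le_card_of_injOn (fun e => (e.1.2 : ℕ)) ?_ ?_
      · intro e he
        simp only [Finset.coe_filter, Finset.mem_univ, true_and, Set.mem_ofPred_eq] at he
        obtain ⟨h0, i, hi, -, -, hd⟩ := he
        rw [VertexPair.dist_eq_iff, h0, zero_add] at hd
        simp only [Finset.coe_range, Set.mem_Iio, hd]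
        exact hFle i hi
      · intro e he e' he' h
        simp only [Finset.coe_filter, Finset.mem_univ, true_and, Set.mem_ofPred_eq] at he he'
        exact Subtype.ext (Prod.ext (Fin.ext (he.1.trans he'.1.symm)) (Fin.ext h))
    · obtain ⟨-, -, i, hi, h0, h1, hd⟩ := Finset.mem_filter.1 he
      exact hcoin i _ hi h0 h1 hd
    · rintro ω ⟨hω₁, hω₀, hω⟩
      obtain ⟨hE, -, hnear⟩ := hstruct ω hω₁ hω₀
      rw [hφ]
      refine ⟨⟨0, by omega⟩, (hE _).2 (Or.inl (by simp only; omega)), ?_⟩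
      have : Nonempty (Fin n) := ⟨⟨0, by omega⟩⟩
      refine atMost_of_finset (U.image fun i : ℕ+ => (⟨min (F i) (n - 1), by omega⟩ : Fin n))
        Finset.card_image_le ?_
      rintro z ⟨hz, hz'⟩
      have hlt : (⟨0, by omega⟩ : Fin n) < z := lt_of_le_of_ne (Nat.zero_le _) hz.ne
      obtain ⟨d, hd, hd', e, he, he', he''⟩ := exists_coin_of_adj_of_lt hω₀ hz hlt
      obtain ⟨i, rfl⟩ : d ∈ Set.range (pnatSpread u v L) := by
        by_contra hd''
        exact hd (hq₀ d hd'')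
      have hzi : (z : ℕ) = F i := by rw [hd', zero_add]; rfl
      have hzn := z.isLt
      have hiL : i ≤ L := by
        by_contra hi
        have h1 := hFge i (not_le.1 hi)
        have h2 := hgap i (by omega)
        have h3 := hnear z hz'
        omega
      rw [hq] at hd
      have hpi : p i = 1 := by
        by_contra hpi
        have := hω e (Finset.mem_filter.2 ⟨Finset.mem_univ _, by simp [he], i, hiL,
          lt_of_le_of_ne unitInterval.nonneg' (Ne.symm hd),
          lt_of_le_of_ne unitInterval.le_one' hpi, he'⟩)
        simp [this] at he''
      exact Finset.mem_image.2 ⟨i, (hmemU i).2 hpi, Fin.ext (by simp only; omega)⟩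
  · -- If the coins at distance `F c` near the ends all succeed, all end vertices have one
    -- more neighbour near the ends.
    refine (satProb_le ?_).trans (sub_le_sub_left ((pow_le_pow_of_le_one hδ.le hδ₁
      (by omega : 2 * A ≤ 3 * A)).trans (pow_le_pairMeasure_prescribed hδ.le hδ₁
      (endPairs n A (pnatSpread u v L c)) (card_endPairs_le _ _ _) (fun _ => true) ?_)) 1)
    · rintro ω ⟨hω₁, hω₀, hω⟩
      obtain ⟨hE, hnear, -⟩ := hstruct ω hω₁ hω₀
      rw [hφ]
      rintro ⟨x, hx, hx'⟩
      rw [hE] at hx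
      have hxn := x.isLt
      have hcU : c ∉ U := fun h => hc₁.ne ((hmemU c).1 h)
      suffices ∃ g : ℕ+ → Fin n, Set.InjOn g (insert c U : Finset ℕ+) ∧
          ∀ i ∈ insert c U, (graphOfPairs ω).Adj x (g i) ∧ NearEnd (graphOfPairs ω) (g i) by
        obtain ⟨g, hg, hg'⟩ := this
        have := hx'.card_le ((insert c U).image g) (by simpa using hg')
        rw [Finset.card_image_of_injOn hg, Finset.card_insert_of_notMem hcU] at this
        omega
      have hWL : ∀ i ∈ insert c U, F i < 3 * A := fun i hi => by
        rcases Finset.mem_insert.1 hi with rfl | hi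
        · exact hFle _ hcL
        · exact hFle _ (hL _ ((hmemU i).1 hi))
      have hadj : ∀ i ∈ insert c U, ∀ y z : Fin n, (z : ℕ) = y + F i → (y = x ∨ z = x) →
          (graphOfPairs ω).Adj y z := by
        intro i hi y z hyz hx''
        have := hWL i hi
        rcases Finset.mem_insert.1 hi with rfl | hi
        · refine graphOfPairs_adj_of_coin (d := pnatSpread u v L i) (fun e he hd => hω e ?_) hyz
          have hd' := (VertexPair.dist_eq_iff _ _).1 hd
          have hd'' : ((pnatSpread u v L i : ℕ+) : ℕ) = F i := rfl
          refine Finset.mem_filter.2 ⟨Finset.mem_univ _, hd, ?_⟩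
          rw [he] at hd' ⊢
          have : (y : ℕ) = x ∨ (z : ℕ) = x := hx''.imp (congrArg _) (congrArg _)
          omega
        · exact graphOfPairs_adj_of_eq_one (d := pnatSpread u v L i) hω₁
            (by rw [hq, (hmemU i).1 hi]) hyz
      rcases hx with hx | hx
      · refine ⟨fun i => ⟨min (x + F i) (n - 1), by omega⟩, fun i hi j hj h => ?_, fun i hi => ?_⟩
        · have := hWL i hi
          have := hWL j hj
          simp only [Fin.mk.injEq] at h
          exact PNat.coe_inj.1 (hFmono.injective (by omega))
        · have := hWL i hi
          exact ⟨hadj i hi _ _ (by simp only; omega) (Or.inl rfl), hnear _ (by simp only; omega)⟩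
      · refine ⟨fun i => ⟨x - F i, by omega⟩, fun i hi j hj h => ?_, fun i hi => ?_⟩
        · have := hWL i hi
          have := hWL j hj
          simp only [Fin.mk.injEq] at h
          exact PNat.coe_inj.1 (hFmono.injective (by omega))
        · have := hWL i hi
          exact ⟨(hadj i hi _ _ (by simp only; omega) (Or.inr rfl)).symm,
            hnear _ (by simp only; omega)⟩
    · intro e he
      exact hcoin c _ hcL hc₀ hc₁ (Finset.mem_filter.1 he).2.1

/-! ### Back-and-forth systems -/

/-- A back-and-forth system between two graphs: `R r x y` says that the second player survives `r`
more rounds of the Ehrenfeucht–Fraïssé game from the position in which the tuples `x` and `y` have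
been chosen. -/
structure BackAndForth {V W : Type} (G : SimpleGraph V) (H : SimpleGraph W)
    (R : ℕ → ∀ k : ℕ, (Fin k → V) → (Fin k → W) → Prop) : Prop where
  eq_iff : ∀ {r k x y}, R r k x y → ∀ i j, x i = x j ↔ y i = y j
  adj_iff : ∀ {r k x y}, R r k x y → ∀ i j, G.Adj (x i) (x j) ↔ H.Adj (y i) (y j)
  mono : ∀ {r k x y}, R (r + 1) k x y → R r k x y
  forth : ∀ {r k x y}, R (r + 1) k x y → ∀ a, ∃ b,
    R r (k + 1) (Fin.snoc (α := fun _ => V) x a) (Fin.snoc (α := fun _ => W) y b)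
  back : ∀ {r k x y}, R (r + 1) k x y → ∀ b, ∃ a,
    R r (k + 1) (Fin.snoc (α := fun _ => V) x a) (Fin.snoc (α := fun _ => W) y b)

section Ehrenfeucht

open FirstOrder FirstOrder.Language

lemma exists_term_eq_var {k : ℕ} (t : Language.graph.Term (Empty ⊕ Fin k)) :
    ∃ i, t = Term.var (Sum.inr i) := by
  cases t with
  | var a =>
    rcases a with a | i
    · exact a.elim
    · exact ⟨i, rfl⟩
  | func f _ => exact isEmptyElim f

/-- Every formula has a number of rounds, depending on the formula only, whose survival implies that
the formula does not distinguish the two positions. -/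
theorem exists_rounds {k : ℕ} (φ : Language.graph.BoundedFormula Empty k) :
    ∃ r, ∀ (V W : Type) (G : SimpleGraph V) (H : SimpleGraph W)
      (R : ℕ → ∀ k : ℕ, (Fin k → V) → (Fin k → W) → Prop), BackAndForth G H R →
      ∀ v w x y, R r k x y →
        (@BoundedFormula.Realize _ V G.structure _ _ φ v x ↔
          @BoundedFormula.Realize _ W H.structure _ _ φ w y) := by
  induction φ with
  | falsum => exact ⟨0, fun _ _ _ _ _ _ _ _ _ _ _ => Iff.rfl⟩
  | equal t₁ t₂ =>
    obtain ⟨i, rfl⟩ := exists_term_eq_var t₁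
    obtain ⟨j, rfl⟩ := exists_term_eq_var t₂
    exact ⟨0, fun V W G H R hR v w x y h => hR.eq_iff h i j⟩
  | rel S ts =>
    rcases S with ⟨⟩
    obtain ⟨i, hi⟩ := exists_term_eq_var (ts 0)
    obtain ⟨j, hj⟩ := exists_term_eq_var (ts 1)
    refine ⟨0, fun V W G H R hR v w x y h => ?_⟩
    have := hR.adj_iff h i j
    change G.Adj (@Term.realize _ V G.structure _ (Sum.elim v x) (ts 0))
      (@Term.realize _ V G.structure _ (Sum.elim v x) (ts 1)) ↔
      H.Adj (@Term.realize _ W H.structure _ (Sum.elim w y) (ts 0))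
      (@Term.realize _ W H.structure _ (Sum.elim w y) (ts 1))
    rw [hi, hj]
    exact this
  | imp φ ψ ihφ ihψ =>
    obtain ⟨r₁, h₁⟩ := ihφ
    obtain ⟨r₂, h₂⟩ := ihψ
    refine ⟨max r₁ r₂, fun V W G H R hR v w x y h => ?_⟩
    have hmono : ∀ {s t}, s ≤ t → R t _ x y → R s _ x y := fun hst =>
      Nat.le_induction id (fun t _ ih ht => ih (hR.mono ht)) _ hst
    exact imp_congr (h₁ V W G H R hR v w x y (hmono (le_max_left _ _) h))
      (h₂ V W G H R hR v w x y (hmono (le_max_right _ _) h))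
  | all φ ih =>
    obtain ⟨r, hr⟩ := ih
    refine ⟨r + 1, fun V W G H R hR v w x y h => ⟨fun hV b => ?_, fun hW a => ?_⟩⟩
    · obtain ⟨a, ha⟩ := hR.back h b
      exact (hr V W G H R hR v w _ _ ha).1 (hV a)
    · obtain ⟨b, hb⟩ := hR.forth h a
      exact (hr V W G H R hR v w _ _ hb).2 (hW b)

end Ehrenfeucht

/-- The 0-1 law holds if for every number of rounds there are events of probabilities tending to `1`
within which the second player survives that many rounds. -/
theorem zeroOneLaw_of_backAndForth {q : ProbSeq} (good : ℕ → ∀ n, Set (VertexPair n → Bool))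
    (hgood : ∀ r, Tendsto (fun n => (pairMeasure q n).real (good r n)) atTop (𝓝 1))
    (h : ∀ r n m, ∀ ω ∈ good r n, ∀ ω' ∈ good r m,
      ∃ R, BackAndForth (graphOfPairs ω) (graphOfPairs ω') R ∧ ∀ x y, R r 0 x y) :
    ZeroOneLaw q := by
  intro φ
  obtain ⟨r, hr⟩ := exists_rounds φ
  have key : ∀ n m, ∀ ω ∈ good r n, ∀ ω' ∈ good r m,
      (GraphSatisfies (graphOfPairs ω) φ ↔ GraphSatisfies (graphOfPairs ω') φ) := by
    intro n m ω hω ω' hω'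
    obtain ⟨R, hR, hR'⟩ := h r n m ω hω ω' hω'
    exact hr _ _ _ _ R hR _ _ _ _ (hR' _ _)
  by_cases hsat : ∃ m, ∃ ω ∈ good r m, GraphSatisfies (graphOfPairs ω) φ
  · right
    obtain ⟨m, ω, hω, hφ⟩ := hsat
    refine tendsto_of_tendsto_of_tendsto_of_le_of_le (hgood r) tendsto_const_nhds
      (fun n => satProb_ge fun ω' hω' => (key m n ω hω ω' hω').1 hφ) fun n => ?_
    exact measureReal_le_one
  · left
    push Not at hsat
    have h0 : Tendsto (fun n => 1 - (pairMeasure q n).real (good r n)) atTop (𝓝 0) := by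
      simpa using (hgood r).const_sub 1
    exact tendsto_of_tendsto_of_tendsto_of_le_of_le tendsto_const_nhds h0
      (fun n => measureReal_nonneg) fun n => satProb_le fun ω hω => hsat n ω hω

/-- Among `k + 1` integers at distances more than `2 * ρ`, one is more than `ρ` away from each of
`k` given integers. -/
lemma exists_far_index {k : ℕ} {ρ : ℤ} (c : Fin (k + 1) → ℤ)
    (hc : ∀ i j, i < j → c i + 2 * ρ < c j) (y : Fin k → ℤ) :
    ∃ j, ∀ i, y i + ρ < c j ∨ c j + ρ < y i := by
  by_contra! h
  choose g hg using h
  obtain ⟨i, j, hij, hgij⟩ := Fintype.exists_ne_map_eq_of_card_lt g (by simp)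
  have h1 := hg i
  have h2 := hg j
  rw [hgij] at h1
  rcases lt_or_gt_of_ne hij with hij | hij
  · have := hc _ _ hij
    omega
  · have := hc _ _ hij
    omega

/-! ### Finitely many distances, none of them random -/

/-- Two tuples in `[n]` and `[m]` are similar at scale `ρ` if corresponding distances between their
members and to the two ends agree or exceed `ρ` in both. -/
def IntervalSim (n m ρ k : ℕ) (x : Fin k → Fin n) (y : Fin k → Fin m) : Prop :=
  (∀ i, (x i : ℕ) = y i ∨ (ρ < x i ∧ ρ < y i)) ∧
  (∀ i, (x i : ℕ) + m = y i + n ∨ (x i + ρ < n ∧ y i + ρ < m)) ∧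
  ∀ i j, (x i : ℕ) + y j = x j + y i ∨
    ((x i + ρ < x j ∨ (x j : ℕ) + ρ < x i) ∧ (y i + ρ < y j ∨ (y j : ℕ) + ρ < y i))

section IntervalSim

variable {n m ρ k : ℕ} {x : Fin k → Fin n} {y : Fin k → Fin m}

lemma IntervalSim.symm (h : IntervalSim n m ρ k x y) : IntervalSim m n ρ k y x := by
  refine ⟨fun i => ?_, fun i => ?_, fun i j => ?_⟩
  · have := h.1 i
    omega
  · have := h.2.1 i
    omega
  · have := h.2.2 i j
    omega

lemma IntervalSim.mono {ρ' : ℕ} (hρ : ρ' ≤ ρ) (h : IntervalSim n m ρ k x y) :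
    IntervalSim n m ρ' k x y := by
  refine ⟨fun i => ?_, fun i => ?_, fun i j => ?_⟩
  · have := h.1 i
    omega
  · have := h.2.1 i
    omega
  · have := h.2.2 i j
    omega

lemma IntervalSim.snoc (h : IntervalSim n m ρ k x y) {a : Fin n} {b : Fin m}
    (hl : (a : ℕ) = b ∨ (ρ < a ∧ ρ < b)) (hr : (a : ℕ) + m = b + n ∨ (a + ρ < n ∧ b + ρ < m))
    (hab : ∀ i, (x i : ℕ) + b = a + y i ∨
      ((x i + ρ < a ∨ (a : ℕ) + ρ < x i) ∧ (y i + ρ < b ∨ (b : ℕ) + ρ < y i))) :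
    IntervalSim n m ρ (k + 1) (Fin.snoc (α := fun _ => Fin n) x a)
      (Fin.snoc (α := fun _ => Fin m) y b) := by
  simp only [IntervalSim, Fin.forall_fin_succ', Fin.snoc_castSucc, Fin.snoc_last]
  refine ⟨⟨h.1, hl⟩, ⟨h.2.1, hr⟩, ⟨fun i => ⟨h.2.2 i, hab i⟩, fun i => ?_, by simp⟩⟩
  have := hab i
  omega

lemma IntervalSim.forth (hn : 2 * ρ < n) (hm : (k + 2) * (2 * ρ + 1) < m)
    (h : IntervalSim n m (2 * ρ) k x y) (a : Fin n) :
    ∃ b, IntervalSim n m ρ (k + 1) (Fin.snoc (α := fun _ => Fin n) x a)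
      (Fin.snoc (α := fun _ => Fin m) y b) := by
  have han := a.isLt
  have h' := h.mono (by omega : ρ ≤ 2 * ρ)
  have hm' : 4 * ρ < m := by nlinarith
  by_cases hl : (a : ℕ) ≤ ρ
  · refine ⟨⟨a, by omega⟩, h'.snoc (Or.inl rfl) (by simp only; omega) fun i => ?_⟩
    have := h.1 i
    simp only
    omega
  by_cases hr : n ≤ a + ρ
  · refine ⟨⟨a + m - n, by omega⟩, h'.snoc (by simp only; omega) (by simp only; omega) fun i => ?_⟩
    have := h.2.1 i
    simp only
    omega
  by_cases hx : ∃ i, (a : ℕ) ≤ x i + ρ ∧ (x i : ℕ) ≤ a + ρ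
  · obtain ⟨i, hi⟩ := hx
    have h1 := h.1 i
    have h2 := h.2.1 i
    refine ⟨⟨y i + a - x i, by omega⟩, h'.snoc (by simp only; omega) (by simp only; omega)
      fun j => ?_⟩
    have := h.2.2 i j
    simp only
    omega
  · push Not at hx
    obtain ⟨j, hj⟩ := exists_far_index (k := k) (ρ := ρ)
      (fun j => ((2 * ρ + 1 : ℕ) : ℤ) * (j + 1)) (fun i j hij => by
        have : ((i : ℕ) : ℤ) + 1 ≤ (j : ℕ) := by exact_mod_cast hij
        push_cast
        nlinarith) (fun i => (y i : ℕ))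
    have hjk : (j : ℕ) ≤ k := by omega
    have hb : (2 * ρ + 1) * (j + 1) + ρ < m := by nlinarith
    have hb' : ρ < (2 * ρ + 1) * (j + 1) := by nlinarith
    have hcast : ((2 * ρ + 1 : ℕ) : ℤ) * (j + 1) = ((2 * ρ + 1) * (j + 1) : ℕ) := by push_cast; ring
    simp only [hcast] at hj
    generalize (2 * ρ + 1) * (j + 1) = b at *
    refine ⟨⟨b, by omega⟩, h'.snoc (by simp only; omega) (by simp only; omega) fun i => ?_⟩
    have h1 := hj i
    have h2 := hx i
    simp only
    omega

end IntervalSim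

/-- If the distances of adjacent vertices form a fixed set that is bounded by `d`, then the
similarities at the scales `2 ^ r * d` form a back-and-forth system, as long as not more than `K`
vertices are chosen. -/
lemma backAndForth_intervalSim {n m d K : ℕ} {G : SimpleGraph (Fin n)} {H : SimpleGraph (Fin m)}
    {D : Set ℕ} (hd : ∀ l ∈ D, l ≤ d)
    (hG : ∀ x y, G.Adj x y ↔ ∃ l ∈ D, (y : ℕ) = x + l ∨ (x : ℕ) = y + l)
    (hH : ∀ x y, H.Adj x y ↔ ∃ l ∈ D, (y : ℕ) = x + l ∨ (x : ℕ) = y + l)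
    (hn : (K + 2) * (2 * (2 ^ K * d) + 1) < n) (hm : (K + 2) * (2 * (2 ^ K * d) + 1) < m) :
    BackAndForth G H fun r k x y => k + r ≤ K ∧ IntervalSim n m (2 ^ r * d) k x y := by
  have hpow : ∀ r, d ≤ 2 ^ r * d := fun r => Nat.le_mul_of_pos_left d (by positivity)
  have hdbl : ∀ r, 2 ^ (r + 1) * d = 2 * (2 ^ r * d) := fun r => by ring
  have hbound : ∀ r k N, k + (r + 1) ≤ K → (K + 2) * (2 * (2 ^ K * d) + 1) < N →
      2 * (2 ^ r * d) < N ∧ (k + 2) * (2 * (2 ^ r * d) + 1) < N := by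
    intro r k N hr hN
    have h1 : 2 ^ r * d ≤ 2 ^ K * d :=
      Nat.mul_le_mul_right d (Nat.pow_le_pow_right (by norm_num) (by omega))
    have h2 : (k + 2) * (2 * (2 ^ r * d) + 1) ≤ (K + 2) * (2 * (2 ^ K * d) + 1) :=
      Nat.mul_le_mul (by omega) (by omega)
    constructor <;> nlinarith
  refine ⟨?_, ?_, ?_, ?_, ?_⟩
  · rintro r k x y ⟨-, h⟩ i j
    have := h.2.2 i j
    rw [Fin.ext_iff, Fin.ext_iff]
    omega
  · rintro r k x y ⟨-, h⟩ i j
    rw [hG, hH]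
    refine exists_congr fun l => and_congr_right fun hl => ?_
    have := h.2.2 i j
    have := hd l hl
    have := hpow r
    omega
  · rintro r k x y ⟨hr, h⟩
    exact ⟨by omega, h.mono (by rw [hdbl]; omega)⟩
  · rintro r k x y ⟨hr, h⟩ a
    rw [hdbl] at h
    obtain ⟨b, hb⟩ := h.forth (hbound r k n hr hn).1 (hbound r k m hr hm).2 a
    exact ⟨b, by omega, hb⟩
  · rintro r k x y ⟨hr, h⟩ b
    rw [hdbl] at h
    obtain ⟨a, ha⟩ := h.symm.forth (hbound r k m hr hm).1 (hbound r k n hr hn).2 b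
    exact ⟨a, by omega, ha.symm⟩

/-- The 0-1 law for a graph that is not random and has finitely many distances. -/
theorem zeroOneLaw_of_finite {q : ProbSeq} (hq : ∀ l, q l = 0 ∨ q l = 1)
    (hfin : (oneSet q).Finite) : ZeroOneLaw q := by
  obtain ⟨d, hd⟩ := hfin.bddAbove
  let D : Set ℕ := {l | ∃ l' : ℕ+, q l' = 1 ∧ (l' : ℕ) = l}
  have hadj : ∀ {n : ℕ} (ω : VertexPair n → Bool), (∀ e, q e.dist = 1 → ω e = true) →
      (∀ e, q e.dist = 0 → ω e = false) → ∀ x y : Fin n,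
      (graphOfPairs ω).Adj x y ↔ ∃ l ∈ D, (y : ℕ) = x + l ∨ (x : ℕ) = y + l := by
    intro n ω h₁ h₀ x y
    constructor
    · intro h
      obtain ⟨l, hl, hl'⟩ := exists_dist_of_adj h₀ h
      exact ⟨l, ⟨l, (hq l).resolve_left hl, rfl⟩, hl'⟩
    · rintro ⟨_, ⟨l, hl, rfl⟩, h | h⟩
      · exact graphOfPairs_adj_of_eq_one h₁ hl h
      · exact (graphOfPairs_adj_of_eq_one h₁ hl h).symm
  refine zeroOneLaw_of_backAndForth (fun r n => {ω | (r + 2) * (2 * (2 ^ r * d) + 1) < n ∧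
    (∀ e, q e.dist = 1 → ω e = true) ∧ ∀ e, q e.dist = 0 → ω e = false}) (fun r => ?_) ?_
  · refine tendsto_const_nhds.congr' ?_
    filter_upwards [eventually_gt_atTop ((r + 2) * (2 * (2 ^ r * (d : ℕ)) + 1))] with n hn
    refine le_antisymm ?_ measureReal_le_one
    have := pow_le_pairMeasure_prescribed (q := q) (n := n) (K := 0) zero_le_one le_rfl ∅ le_rfl
      (fun _ => true) (by simp)
    rw [pow_zero] at this
    refine this.trans (measureReal_mono ?_)
    rintro ω ⟨h₁, h₀, -⟩
    exact ⟨hn, h₁, h₀⟩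
  · rintro r n m ω ⟨hn, h₁, h₀⟩ ω' ⟨hm, h₁', h₀'⟩
    refine ⟨_, backAndForth_intervalSim (d := d) (D := D) ?_ (hadj ω h₁ h₀) (hadj ω' h₁' h₀') hn hm,
      fun x y => ⟨by omega, fun i => i.elim0, fun i => i.elim0, fun i => i.elim0⟩⟩
    rintro _ ⟨l, hl, rfl⟩
    exact hd hl

/-! ### One random distance: the game on disjoint paths -/

/-- In a graph on integers all of whose edges join vertices at distance `l`, the vertex `x` and the
vertex `t` steps of length `l` to the right of it (to the left, if `t` is negative) are joined by a
path. The graph is encoded by `E`, where `E z` is read as: `z` and `z + l` are adjacent. -/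
def Chained (E : ℤ → Prop) (l x t : ℤ) : Prop :=
  ∀ s, min 0 t ≤ s → s < max 0 t → E (x + s * l)

/-- The vertex `y` is the one `t` steps from `x` on the path through `x`. -/
def Linked (E : ℤ → Prop) (l x t y : ℤ) : Prop :=
  y = x + t * l ∧ Chained E l x t

section Chained

variable {E : ℤ → Prop} {l x y t u : ℤ}

lemma chained_zero : Chained E l x 0 := fun s h h' => by omega

lemma Chained.add_iff (h : Chained E l x t) :
    Chained E l (x + t * l) u ↔ Chained E l x (t + u) := by
  constructor
  · intro h' s hs hs'
    by_cases hst : min 0 t ≤ s ∧ s < max 0 t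
    · exact h s hst.1 hst.2
    · have := h' (s - t) (by omega) (by omega)
      rwa [show x + t * l + (s - t) * l = x + s * l by ring] at this
  · intro h' s hs hs'
    rw [show x + t * l + s * l = x + (t + s) * l by ring]
    by_cases hst : min 0 t ≤ t + s ∧ t + s < max 0 t
    · exact h _ hst.1 hst.2
    · exact h' _ (by omega) (by omega)

lemma Chained.neg (h : Chained E l x t) : Chained E l (x + t * l) (-t) := by
  rw [h.add_iff, add_neg_cancel]
  exact chained_zero

lemma Chained.mono (h : Chained E l x t) (hu : min 0 t ≤ u) (hu' : u ≤ max 0 t) :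
    Chained E l x u := fun s hs hs' => h s (by omega) (by omega)

lemma linked_comm : Linked E l x t y ↔ Linked E l y (-t) x := by
  have key : ∀ {x y t}, Linked E l x t y → Linked E l y (-t) x := by
    rintro x y t ⟨rfl, h⟩
    exact ⟨by ring, h.neg⟩
  exact ⟨key, fun h => neg_neg t ▸ key h⟩

lemma Chained.linked_add_iff (h : Chained E l x t) :
    Linked E l (x + t * l) u y ↔ Linked E l x (t + u) y := by
  rw [Linked, Linked, h.add_iff, add_mul, add_assoc]

lemma linked_self_iff (hl : 0 < l) : Linked E l x t x ↔ t = 0 := by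
  constructor
  · rintro ⟨h, -⟩
    have : t * l = 0 := by linarith
    exact (mul_eq_zero.1 this).resolve_right hl.ne'
  · rintro rfl
    exact ⟨by ring, chained_zero⟩

/-- A path starting within an interval that contains all the edges stays within it. -/
lemma Chained.mem_range {n : ℤ} (h : Chained E l x t) (hl : 0 < l)
    (hE : ∀ z, E z → 0 ≤ z ∧ z + l < n) (hx : 0 ≤ x ∧ x < n) :
    0 ≤ x + t * l ∧ x + t * l < n := by
  rcases lt_trichotomy t 0 with ht | rfl | ht
  · have := hE _ (h t (by omega) (by omega))
    omega
  · simpa using hx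
  · have := hE _ (h (t - 1) (by omega) (by omega))
    rw [show x + t * l = x + (t - 1) * l + l by ring]
    omega

/-- Within distance `ρ` the path through a vertex is described by its truncated lengths to both
sides. -/
lemma exists_chained_iff (E : ℤ → Prop) (l x : ℤ) (ρ : ℕ) : ∃ α ≤ ρ, ∃ β ≤ ρ,
    ∀ t : ℤ, |t| ≤ ρ → (Chained E l x t ↔ -(α : ℤ) ≤ t ∧ t ≤ β) := by
  classical
  refine ⟨Nat.findGreatest (fun a => Chained E l x (-a)) ρ, Nat.findGreatest_le ρ,
    Nat.findGreatest (fun b => Chained E l x b) ρ, Nat.findGreatest_le ρ, fun t ht => ?_⟩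
  rw [abs_le] at ht
  constructor
  · intro h
    constructor
    · rcases le_or_gt 0 t with h0 | h0
      · omega
      · have := Nat.le_findGreatest (P := fun a : ℕ => Chained E l x (-a)) (m := t.natAbs) (n := ρ)
          (by omega) (by rwa [show -(t.natAbs : ℤ) = t by omega])
        omega
    · rcases le_or_gt t 0 with h0 | h0
      · omega
      · have := Nat.le_findGreatest (P := fun a : ℕ => Chained E l x a) (m := t.natAbs) (n := ρ)
          (by omega) (by rwa [show (t.natAbs : ℤ) = t by omega])
        omega
  · rintro ⟨h1, h2⟩
    have hα := Nat.findGreatest_spec (P := fun a : ℕ => Chained E l x (-a)) (Nat.zero_le ρ)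
      (by simpa using chained_zero)
    have hβ := Nat.findGreatest_spec (P := fun a : ℕ => Chained E l x a) (Nat.zero_le ρ)
      (by simpa using chained_zero)
    rcases le_or_gt t 0 with h0 | h0
    · exact hα.mono (by omega) (by omega)
    · exact hβ.mono (by omega) (by omega)

/-- The lengths of the path through `x` are read off from the edges near `x`. -/
lemma chained_iff_of_pattern {ρ α β : ℤ} (hα : 0 ≤ α) (hβ : 0 ≤ β)
    (h : ∀ s, -ρ ≤ s → s < ρ → (E (x + s * l) ↔ -α ≤ s ∧ s < β)) (ht : |t| ≤ ρ) :
    Chained E l x t ↔ -α ≤ t ∧ t ≤ β := by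
  rw [abs_le] at ht
  constructor
  · intro hc
    constructor
    · by_contra hlt
      have := (h t (by omega) (by omega)).1 (hc t (by omega) (by omega))
      omega
    · by_contra hlt
      have := (h (t - 1) (by omega) (by omega)).1 (hc (t - 1) (by omega) (by omega))
      omega
  · intro hab s hs hs'
    exact (h s (by omega) (by omega)).2 (by omega)

end Chained

/-- Two tuples of vertices are similar at scale `ρ` if the paths through corresponding members have
the same truncated lengths, and corresponding members are at the same distances on these paths. -/
def PathSim (E E' : ℤ → Prop) (l : ℤ) (ρ k : ℕ) (x y : Fin k → ℤ) : Prop :=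
  (∀ i t, |t| ≤ (ρ : ℤ) → (Chained E l (x i) t ↔ Chained E' l (y i) t)) ∧
  ∀ i j t, |t| ≤ (ρ : ℤ) → (Linked E l (x i) t (x j) ↔ Linked E' l (y i) t (y j))

/-- There are `K + 1` vertices of each local type, far from each other. -/
def Rich (E : ℤ → Prop) (l n : ℤ) (ρ K : ℕ) : Prop :=
  ∀ α ≤ ρ, ∀ β ≤ ρ, ∃ c : Fin (K + 1) → ℤ, (∀ i j, i < j → c i + 2 * (ρ * l) < c j) ∧
    ∀ j, (0 ≤ c j ∧ c j < n) ∧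
      ∀ t : ℤ, |t| ≤ ρ → (Chained E l (c j) t ↔ -(α : ℤ) ≤ t ∧ t ≤ β)

section PathSim

variable {E E' : ℤ → Prop} {l n m : ℤ} {ρ k K : ℕ} {x y : Fin k → ℤ}

lemma Rich.mono {ρ' : ℕ} (h : Rich E l n ρ K) (hl : 0 < l) (hρ : ρ' ≤ ρ) : Rich E l n ρ' K := by
  intro α hα β hβ
  obtain ⟨c, hc, hc'⟩ := h α (hα.trans hρ) β (hβ.trans hρ)
  have hρ' : (ρ' : ℤ) ≤ ρ := by exact_mod_cast hρ
  refine ⟨c, fun i j hij => ?_, fun j => ⟨(hc' j).1, fun t ht => (hc' j).2 t (ht.trans hρ')⟩⟩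
  have := hc i j hij
  nlinarith

lemma PathSim.symm (h : PathSim E E' l ρ k x y) : PathSim E' E l ρ k y x :=
  ⟨fun i t ht => (h.1 i t ht).symm, fun i j t ht => (h.2 i j t ht).symm⟩

lemma PathSim.mono {ρ' : ℕ} (h : PathSim E E' l ρ k x y) (hρ : ρ' ≤ ρ) :
    PathSim E E' l ρ' k x y := by
  have hρ' : (ρ' : ℤ) ≤ ρ := by exact_mod_cast hρ
  exact ⟨fun i t ht => h.1 i t (ht.trans hρ'), fun i j t ht => h.2 i j t (ht.trans hρ')⟩

lemma PathSim.snoc (h : PathSim E E' l ρ k x y) (hl : 0 < l) {a b : ℤ}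
    (h₁ : ∀ t, |t| ≤ (ρ : ℤ) → (Chained E l a t ↔ Chained E' l b t))
    (h₂ : ∀ i t, |t| ≤ (ρ : ℤ) → (Linked E l (x i) t a ↔ Linked E' l (y i) t b)) :
    PathSim E E' l ρ (k + 1) (Fin.snoc (α := fun _ => ℤ) x a) (Fin.snoc (α := fun _ => ℤ) y b) := by
  simp only [PathSim, Fin.forall_fin_succ', Fin.snoc_castSucc, Fin.snoc_last]
  refine ⟨⟨h.1, h₁⟩, fun i => ⟨h.2 i, h₂ i⟩, fun j t ht => ?_, fun t _ => ?_⟩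
  · rw [linked_comm, h₂ j (-t) (by rwa [abs_neg]), ← linked_comm]
  · rw [linked_self_iff hl, linked_self_iff hl]

lemma PathSim.forth (hl : 0 < l) (hE' : ∀ z, E' z → 0 ≤ z ∧ z + l < m) (hrich : Rich E' l m ρ K)
    (hk : k ≤ K) (hy : ∀ i, 0 ≤ y i ∧ y i < m) (h : PathSim E E' l (2 * ρ) k x y) (a : ℤ) :
    ∃ b, (0 ≤ b ∧ b < m) ∧ PathSim E E' l ρ (k + 1) (Fin.snoc (α := fun _ => ℤ) x a)
      (Fin.snoc (α := fun _ => ℤ) y b) := by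
  have h' := h.mono (by omega : ρ ≤ 2 * ρ)
  by_cases hx : ∃ i t, |t| ≤ (ρ : ℤ) ∧ Linked E l (x i) t a
  · -- A vertex close to one chosen before: copy its position relative to that one.
    obtain ⟨i, t, ht, rfl, hc⟩ := hx
    have hc' : Chained E' l (y i) t := (h'.1 i t ht).1 hc
    have habs : ∀ u, |u| ≤ (ρ : ℤ) → |t + u| ≤ ((2 * ρ : ℕ) : ℤ) := fun u hu => by
      rw [abs_le] at *
      push_cast
      omega
    refine ⟨y i + t * l, hc'.mem_range hl hE' (hy i), h'.snoc hl (fun u hu => ?_) fun j u hu => ?_⟩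
    · rw [hc.add_iff, hc'.add_iff, h.1 i _ (habs u hu)]
    · rw [linked_comm, hc.linked_add_iff, linked_comm (x := y j), hc'.linked_add_iff]
      exact h.2 i j _ (habs (-u) (by rwa [abs_neg]))
  · -- A vertex far from all chosen before: take one of the same local type.
    push Not at hx
    obtain ⟨α, hα, β, hβ, hab⟩ := exists_chained_iff E l a ρ
    obtain ⟨c, hc, hc'⟩ := hrich α hα β hβ
    obtain ⟨j, hj⟩ := exists_far_index (k := k) (ρ := ρ * l)
      (fun j => c (Fin.castLE (by omega) j)) (fun i j hij => hc _ _ hij) y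
    refine ⟨_, (hc' (Fin.castLE (by omega) j)).1, h'.snoc hl (fun t ht => ?_) fun i t ht => ?_⟩
    · rw [hab t ht, (hc' _).2 t ht]
    · refine iff_of_false (hx i t ht) ?_
      rintro ⟨h1, -⟩
      rw [abs_le] at ht
      have h2 : -(ρ * l) ≤ t * l := by nlinarith
      have h3 : t * l ≤ ρ * l := by nlinarith
      have := hj i
      omega

end PathSim

/-- The vertices `z` and `z + l` of `[n]` are adjacent. -/
def Step {n : ℕ} (G : SimpleGraph (Fin n)) (l z : ℤ) : Prop :=
  ∃ x y : Fin n, (x : ℤ) = z ∧ (y : ℤ) = z + l ∧ G.Adj x y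

/-- The similarities at the scales `2 ^ r` form a back-and-forth system, as long as not more than
`K` vertices are chosen. -/
lemma backAndForth_pathSim {n m K : ℕ} {G : SimpleGraph (Fin n)} {H : SimpleGraph (Fin m)} {l : ℤ}
    (hl : 0 < l) (hG : ∀ x y, G.Adj x y → (y : ℤ) = x + l ∨ (x : ℤ) = y + l)
    (hH : ∀ x y, H.Adj x y → (y : ℤ) = x + l ∨ (x : ℤ) = y + l)
    (hG' : Rich (Step G l) l n (2 ^ K) K) (hH' : Rich (Step H l) l m (2 ^ K) K) :
    BackAndForth G H fun r k x y => k + r ≤ K ∧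
      PathSim (Step G l) (Step H l) l (2 ^ r) k (fun i => x i) (fun i => y i) := by
  have hsnoc : ∀ {k N : ℕ} (x : Fin k → Fin N) (a : Fin N),
      (fun i => ((Fin.snoc (α := fun _ => Fin N) x a i : Fin N) : ℤ)) =
        Fin.snoc (α := fun _ => ℤ) (fun i => ((x i : Fin N) : ℤ)) (a : ℤ) := by
    intro k N x a
    funext i
    refine Fin.lastCases ?_ (fun i => ?_) i <;> simp
  have hstep : ∀ {N : ℕ} (G : SimpleGraph (Fin N)) z, Step G l z → 0 ≤ z ∧ z + l < N := by
    rintro N G z ⟨x, y, hx, hy, -⟩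
    omega
  have hadj : ∀ {N : ℕ} (G : SimpleGraph (Fin N)),
      (∀ x y, G.Adj x y → (y : ℤ) = x + l ∨ (x : ℤ) = y + l) → ∀ x y,
      (G.Adj x y ↔ Linked (Step G l) l x 1 y ∨ Linked (Step G l) l x (-1) y) := by
    intro N G hG x y
    have hright : ∀ x y : Fin N, Linked (Step G l) l x 1 y ↔ (y : ℤ) = x + l ∧ G.Adj x y := by
      intro x y
      rw [Linked, one_mul]
      refine and_congr_right fun hxy => ⟨fun h => ?_, fun h s hs hs' => ?_⟩
      · obtain ⟨x', y', hx', hy', hadj⟩ := h 0 (by omega) (by omega)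
        obtain rfl : x' = x := Fin.ext (by omega)
        obtain rfl : y' = y := Fin.ext (by omega)
        exact hadj
      · obtain rfl : s = 0 := by omega
        exact ⟨x, y, by ring, by omega, h⟩
    rw [linked_comm (t := -1), neg_neg, hright, hright]
    constructor
    · intro h
      exact (hG x y h).imp (fun h' => ⟨h', h⟩) fun h' => ⟨h', h.symm⟩
    · rintro (⟨-, h⟩ | ⟨-, h⟩)
      · exact h
      · exact h.symm
  have hforth : ∀ {N M r k : ℕ} {G : SimpleGraph (Fin N)} {H : SimpleGraph (Fin M)}
      {x : Fin k → Fin N} {y : Fin k → Fin M}, Rich (Step H l) l M (2 ^ K) K → k + (r + 1) ≤ K →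
      PathSim (Step G l) (Step H l) l (2 ^ (r + 1)) k (fun i => x i) (fun i => y i) → ∀ a : Fin N,
      ∃ b : Fin M, PathSim (Step G l) (Step H l) l (2 ^ r) (k + 1)
        (fun i => (Fin.snoc (α := fun _ => Fin N) x a i : Fin N))
        (fun i => (Fin.snoc (α := fun _ => Fin M) y b i : Fin M)) := by
    intro N M r k G H x y hH hk h a
    rw [pow_succ, mul_comm] at h
    obtain ⟨b, hb, hb'⟩ := h.forth hl (hstep H)
      (hH.mono hl (Nat.pow_le_pow_right (by norm_num) (by omega : r ≤ K)))
      (by omega) (fun i => by simp) (a : ℤ)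
    lift b to ℕ using hb.1
    refine ⟨⟨b, by omega⟩, ?_⟩
    rw [hsnoc, hsnoc]
    exact hb'
  have hone : ∀ r, (1 : ℤ) ≤ ((2 ^ r : ℕ) : ℤ) := fun r => by
    exact_mod_cast Nat.one_le_two_pow
  refine ⟨?_, ?_, ?_, ?_, ?_⟩
  · rintro r k x y ⟨-, h⟩ i j
    have := h.2 j i 0 (by simp)
    simpa [Linked, chained_zero, Fin.ext_iff] using this
  · rintro r k x y ⟨-, h⟩ i j
    rw [hadj G hG, hadj H hH]
    exact or_congr (h.2 i j 1 (by simpa using hone r)) (h.2 i j (-1) (by simpa using hone r))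
  · rintro r k x y ⟨hr, h⟩
    exact ⟨by omega, h.mono (Nat.pow_le_pow_right (by norm_num) (by omega))⟩
  · rintro r k x y ⟨hr, h⟩ a
    obtain ⟨b, hb⟩ := hforth hH' hr h a
    exact ⟨b, by omega, hb⟩
  · rintro r k x y ⟨hr, h⟩ b
    obtain ⟨a, ha⟩ := hforth hG' hr h.symm b
    exact ⟨a, by omega, ha.symm⟩

/-! ### One random distance: all local types occur often -/

/-- Events that depend on disjoint sets of coins are independent. -/
lemma pairMeasure_inter_of_disjoint (q : ProbSeq) {n : ℕ} {S T : Finset (VertexPair n)}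
    (hST : Disjoint S T) {A B : Set (VertexPair n → Bool)}
    (hA : ∀ ω ω', (∀ e ∈ S, ω e = ω' e) → ω ∈ A → ω' ∈ A)
    (hB : ∀ ω ω', (∀ e ∈ T, ω e = ω' e) → ω ∈ B → ω' ∈ B) :
    (pairMeasure q n).real (A ∩ B) = (pairMeasure q n).real A * (pairMeasure q n).real B := by
  have hindep : iIndepFun (fun (e : VertexPair n) (ω : VertexPair n → Bool) => ω e)
      (pairMeasure q n) :=
    iIndepFun_pi (X := fun _ => id) fun _ => aemeasurable_id
  have key := (hindep.indepFun_finset S T hST fun e =>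
    measurable_pi_apply e).measure_inter_preimage_eq_mul
    {w | ∀ ω : VertexPair n → Bool, (∀ e : S, ω e = w e) → ω ∈ A}
    {w | ∀ ω : VertexPair n → Bool, (∀ e : T, ω e = w e) → ω ∈ B}
    (Set.toFinite _).measurableSet (Set.toFinite _).measurableSet
  have hA' : (fun (ω : VertexPair n → Bool) (e : S) => ω e) ⁻¹'
      {w | ∀ ω : VertexPair n → Bool, (∀ e : S, ω e = w e) → ω ∈ A} = A := by
    ext ω
    exact ⟨fun h => h ω fun _ => rfl, fun h ω' hω' =>
      hA ω ω' (fun e he => (hω' ⟨e, he⟩).symm) h⟩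
  have hB' : (fun (ω : VertexPair n → Bool) (e : T) => ω e) ⁻¹'
      {w | ∀ ω : VertexPair n → Bool, (∀ e : T, ω e = w e) → ω ∈ B} = B := by
    ext ω
    exact ⟨fun h => h ω fun _ => rfl, fun h ω' hω' =>
      hB ω ω' (fun e he => (hω' ⟨e, he⟩).symm) h⟩
  rw [hA', hB'] at key
  rw [measureReal_def, key, ENNReal.toReal_mul]
  rfl

/-- If each of `N` disjoint blocks of coins shows a prescribed pattern with probability at least
`δ`, then none of them shows it with probability at most `(1 - δ) ^ N`. -/
lemma pairMeasure_forall_not_le (q : ProbSeq) {n : ℕ} (S : ℕ → Finset (VertexPair n))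
    (hS : Pairwise fun a b => Disjoint (S a) (S b)) (v : VertexPair n → Bool) {δ : ℝ} (hδ₁ : δ ≤ 1)
    (N : ℕ) (hδ : ∀ b < N, δ ≤ (pairMeasure q n).real {ω | ∀ e ∈ S b, ω e = v e}) :
    (pairMeasure q n).real {ω | ∀ b < N, ¬ ∀ e ∈ S b, ω e = v e} ≤ (1 - δ) ^ N := by
  classical
  induction N with
  | zero => simp
  | succ N ih =>
    have hsplit : {ω : VertexPair n → Bool | ∀ b < N + 1, ¬ ∀ e ∈ S b, ω e = v e} =
        {ω | ∀ b < N, ¬ ∀ e ∈ S b, ω e = v e} ∩ {ω | ∀ e ∈ S N, ω e = v e}ᶜ := by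
      ext ω
      simp only [Nat.lt_succ_iff_lt_or_eq, Set.mem_ofPred_eq, Set.mem_inter_iff, Set.mem_compl_iff]
      exact ⟨fun h => ⟨fun b hb => h b (Or.inl hb), h N (Or.inr rfl)⟩, fun h b hb =>
        hb.elim (h.1 b) fun hb => hb ▸ h.2⟩
    rw [hsplit, pairMeasure_inter_of_disjoint q (S := (Finset.range N).biUnion S) (T := S N),
      pow_succ]
    · refine mul_le_mul (ih fun b hb => hδ b (by omega)) ?_ measureReal_nonneg
        (pow_nonneg (sub_nonneg.2 hδ₁) N)
      rw [probReal_compl_eq_one_sub (Set.toFinite _).measurableSet]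
      exact sub_le_sub_left (hδ N (Nat.lt_succ_self N)) 1
    · exact (Finset.disjoint_biUnion_left _ _ _).2 fun b hb => hS (Finset.mem_range.1 hb).ne
    · intro ω ω' h hω b hb hω'
      exact hω b hb fun e he =>
        (h e (Finset.mem_biUnion.2 ⟨b, Finset.mem_range.2 hb, he⟩)).trans (hω' e he)
    · intro ω ω' h hω hω'
      exact hω fun e he => (h e he).trans (hω' e he)

/-- The `b`-th block of coins: those of the pairs `z < z + l` where `z` is `s * l` for one of the
numbers `s` from `b * (2 * ρ + 1)` to `b * (2 * ρ + 1) + 2 * ρ - 1`. -/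
def coinBlock (n : ℕ) (l : ℕ+) (ρ b : ℕ) : Finset (VertexPair n) :=
  Finset.univ.filter fun e => e.dist = l ∧ ∃ s < 2 * ρ, (e.1.1 : ℕ) = (b * (2 * ρ + 1) + s) * l

lemma div_mod_of_eq {l ρ b s z : ℕ} (hl : 0 < l) (hs : s < 2 * ρ)
    (hz : z = (b * (2 * ρ + 1) + s) * l) :
    z / l / (2 * ρ + 1) = b ∧ z / l % (2 * ρ + 1) = s := by
  rw [hz, Nat.mul_div_cancel _ hl]
  constructor
  · rw [Nat.add_comm, Nat.add_mul_div_right _ _ (by omega), Nat.div_eq_of_lt (by omega), zero_add]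
  · rw [Nat.add_comm, Nat.add_mul_mod_self_right, Nat.mod_eq_of_lt (by omega)]

lemma pairwise_disjoint_coinBlock (n : ℕ) (l : ℕ+) (ρ : ℕ) :
    Pairwise fun a b => Disjoint (coinBlock n l ρ a) (coinBlock n l ρ b) := by
  intro a b hab
  rw [Finset.disjoint_left]
  intro e ha hb
  obtain ⟨-, -, s, hs, hz⟩ := Finset.mem_filter.1 ha
  obtain ⟨-, -, s', hs', hz'⟩ := Finset.mem_filter.1 hb
  exact hab ((div_mod_of_eq l.pos hs hz).1.symm.trans (div_mod_of_eq l.pos hs' hz').1)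

lemma card_coinBlock_le (n : ℕ) (l : ℕ+) (ρ b : ℕ) : (coinBlock n l ρ b).card ≤ 2 * ρ := by
  rw [← Finset.card_range (2 * ρ)]
  refine Finset.card_le_card_of_injOn (fun e => (e.1.1 : ℕ) / l % (2 * ρ + 1)) ?_ ?_
  · intro e he
    obtain ⟨-, -, s, hs, hz⟩ := Finset.mem_filter.1 he
    simpa [(div_mod_of_eq l.pos hs hz).2] using hs
  · intro e he e' he' h
    obtain ⟨-, hd, s, hs, hz⟩ := Finset.mem_filter.1 he
    obtain ⟨-, hd', s', hs', hz'⟩ := Finset.mem_filter.1 he'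
    simp only [(div_mod_of_eq l.pos hs hz).2, (div_mod_of_eq l.pos hs' hz').2] at h
    rw [VertexPair.dist_eq_iff] at hd hd'
    have h1 : (e.1.1 : ℕ) = e'.1.1 := by rw [hz, hz', h]
    exact Subtype.ext (Prod.ext (Fin.ext h1) (Fin.ext (by omega)))

/-- The pattern of a block that makes the path through its centre extend by `α` steps to the left
and by `β` steps to the right. -/
def blockPattern {n : ℕ} (l : ℕ+) (ρ α β : ℕ) (e : VertexPair n) : Bool :=
  decide (ρ ≤ (e.1.1 : ℕ) / l % (2 * ρ + 1) + α ∧ (e.1.1 : ℕ) / l % (2 * ρ + 1) < ρ + β)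

lemma chained_of_pattern {n : ℕ} {l : ℕ+} {ρ α β b : ℕ} {ω : VertexPair n → Bool}
    (hω : ∀ e ∈ coinBlock n l ρ b, ω e = blockPattern l ρ α β e)
    (hn : (b + 1) * (2 * ρ + 1) * l < n)
    {t : ℤ} (ht : |t| ≤ ρ) :
    Chained (Step (graphOfPairs ω) l) l ((b * (2 * ρ + 1) + ρ) * l : ℕ) t ↔
      -(α : ℤ) ≤ t ∧ t ≤ β := by
  refine chained_iff_of_pattern (ρ := ρ) (by positivity) (by positivity) (fun s hs hs' => ?_) ht
  obtain ⟨s', hs''⟩ : ∃ s' : ℕ, (s' : ℤ) = ρ + s := ⟨(ρ + s).toNat, by omega⟩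
  have hs₂ : s' < 2 * ρ := by omega
  set z : ℕ := (b * (2 * ρ + 1) + s') * l with hz
  have hzn : z + l < n := by
    refine lt_of_le_of_lt ?_ hn
    calc z + l = (b * (2 * ρ + 1) + s' + 1) * l := by rw [hz]; ring
      _ ≤ (b + 1) * (2 * ρ + 1) * l := Nat.mul_le_mul_right _ (by nlinarith)
  have hcast : (((b * (2 * ρ + 1) + ρ) * l : ℕ) : ℤ) + s * l = z := by
    rw [hz]
    push_cast
    rw [hs'']
    ring
  have hlt : (⟨z, by omega⟩ : Fin n) < ⟨z + l, hzn⟩ := by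
    rw [Fin.lt_def]
    exact Nat.lt_add_of_pos_right l.pos
  have hmem : (⟨(⟨z, by omega⟩, ⟨z + l, hzn⟩), hlt⟩ : VertexPair n) ∈ coinBlock n l ρ b :=
    Finset.mem_filter.2 ⟨Finset.mem_univ _, (VertexPair.dist_eq_iff _ _).2 rfl, s', hs₂, hz⟩
  have hstep : Step (graphOfPairs ω) l z ↔
      (graphOfPairs ω).Adj ⟨z, by omega⟩ ⟨z + l, hzn⟩ := by
    constructor
    · rintro ⟨x, y, hx, hy, h⟩
      have hx' : x = ⟨z, by omega⟩ := Fin.ext (by simp only; omega)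
      have hy' : y = ⟨z + l, hzn⟩ := Fin.ext (by simp only; omega)
      rwa [hx', hy'] at h
    · exact fun h => ⟨_, _, rfl, by push_cast; rfl, h⟩
  rw [hcast, hstep, graphOfPairs_adj_of_lt hlt, hω _ hmem, blockPattern, decide_eq_true_iff]
  simp only [(div_mod_of_eq l.pos hs₂ hz).2]
  omega

/-- If among the blocks of each of `K + 1` consecutive segments of length `N` one has the pattern,
for all patterns, then all local types occur often. -/
lemma rich_of_coinBlocks {n : ℕ} {l : ℕ+} {ρ K N : ℕ} {ω : VertexPair n → Bool}
    (hn : (K + 1) * N * (2 * ρ + 1) * l < n)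
    (h : ∀ α ≤ ρ, ∀ β ≤ ρ, ∀ i ≤ K, ∃ b < N, ∀ e ∈ coinBlock n l ρ (i * N + b),
      ω e = blockPattern l ρ α β e) :
    Rich (Step (graphOfPairs ω) l) l n ρ K := by
  intro α hα β hβ
  choose! g hg hg' using h α hα β hβ
  have hi : ∀ i : Fin (K + 1), (i : ℕ) ≤ K := fun i => Nat.lt_succ_iff.1 i.2
  have hbound : ∀ i : Fin (K + 1), (i * N + g i + 1) * (2 * ρ + 1) * l < n := fun i => by
    refine lt_of_le_of_lt ?_ hn
    have h1 : (i : ℕ) * N ≤ K * N := Nat.mul_le_mul_right N (hi i)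
    have h2 := hg i (hi i)
    have h3 : (i : ℕ) * N + g i + 1 ≤ (K + 1) * N := by nlinarith
    exact Nat.mul_le_mul_right _ (Nat.mul_le_mul_right _ h3)
  refine ⟨fun i => (((i * N + g i) * (2 * ρ + 1) + ρ) * l : ℕ), fun i j hij => ?_,
    fun i => ⟨⟨by positivity, ?_⟩, fun t ht => chained_of_pattern (hg' i (hi i)) (hbound i) ht⟩⟩
  · have h1 : ((i : ℕ) + 1) * N ≤ j * N := Nat.mul_le_mul_right N hij
    have h2 := hg i (hi i)
    have h3 : (i : ℕ) * N + g i + 1 ≤ j * N + g j := by nlinarith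
    have h4 := Nat.mul_le_mul_right (2 * ρ + 1) h3
    have hl := l.pos
    have h5 : (i * N + g i) * (2 * ρ + 1) + ρ + 2 * ρ < (j * N + g j) * (2 * ρ + 1) + ρ := by
      nlinarith
    have h6 := Nat.mul_lt_mul_of_pos_right h5 hl
    have h7 : ((i * N + g i) * (2 * ρ + 1) + ρ) * l + 2 * (ρ * l) <
      ((j * N + g j) * (2 * ρ + 1) + ρ) * l := by nlinarith
    beta_reduce
    exact_mod_cast h7
  · have h1 : ((i * N + g i) * (2 * ρ + 1) + ρ) * l ≤ (i * N + g i + 1) * (2 * ρ + 1) * l :=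
      Nat.mul_le_mul_right _ (by nlinarith)
    beta_reduce
    exact_mod_cast h1.trans_lt (hbound i)

/-- With the edges at distance `l` random and no others, the probability that not all local types
occur often tends to zero exponentially fast. -/
lemma one_sub_le_pairMeasure_rich {q : ProbSeq} {l : ℕ+} {δ : ℝ} (hl₀ : 0 < q l) (hl₁ : q l < 1)
    (hδ₀ : 0 ≤ δ) (hδ : δ ≤ q l) (hδ' : δ ≤ 1 - q l) {n ρ K N : ℕ}
    (hn : (K + 1) * N * (2 * ρ + 1) * l < n) :
    1 - (ρ + 1) * (ρ + 1) * (K + 1) * (1 - δ ^ (2 * ρ)) ^ N ≤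
      (pairMeasure q n).real {ω | (∀ e, q e.dist = 0 → ω e = false) ∧
        Rich (Step (graphOfPairs ω) l) l n ρ K} := by
  classical
  have hδ₁ : δ ≤ 1 := hδ.trans (q l).2.2
  set μ := pairMeasure q n
  set compat : Set (VertexPair n → Bool) := {ω | ∀ e, q e.dist = 0 → ω e = false}
  set I : Finset (ℕ × ℕ × ℕ) :=
    Finset.range (ρ + 1) ×ˢ Finset.range (ρ + 1) ×ˢ Finset.range (K + 1) with hI
  set bad : ℕ × ℕ × ℕ → Set (VertexPair n → Bool) := fun a =>
    {ω | ∀ b < N, ¬ ∀ e ∈ coinBlock n l ρ (a.2.2 * N + b), ω e = blockPattern l ρ a.1 a.2.1 e}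
  have hcompat : μ.real compatᶜ = 0 := by
    have := pow_le_pairMeasure_prescribed (q := q) (n := n) (K := 0) zero_le_one le_rfl ∅ le_rfl
      (fun _ => true) (by simp)
    rw [pow_zero] at this
    have h1 : 1 ≤ μ.real compat := this.trans (measureReal_mono fun ω hω => hω.2.1)
    rw [probReal_compl_eq_one_sub (Set.toFinite _).measurableSet]
    exact sub_eq_zero.2 (le_antisymm h1 measureReal_le_one)
  have hbad : ∀ a, μ.real (bad a) ≤ (1 - δ ^ (2 * ρ)) ^ N := by
    intro a
    refine pairMeasure_forall_not_le q _
      (fun b b' hb => pairwise_disjoint_coinBlock n l ρ (by simpa))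
      _ (pow_le_one₀ hδ₀ hδ₁) N fun b _ => ?_
    refine (pow_le_pairMeasure_prescribed hδ₀ hδ₁ _ (card_coinBlock_le n l ρ _) _
      fun e he => ?_).trans (measureReal_mono fun ω hω => hω.2.2)
    rw [(Finset.mem_filter.1 he).2.1]
    exact ⟨hl₀, hl₁, hδ, hδ'⟩
  have hsub : {ω | (∀ e, q e.dist = 0 → ω e = false) ∧
      Rich (Step (graphOfPairs ω) l) l n ρ K}ᶜ ⊆ compatᶜ ∪ ⋃ a ∈ I, bad a := by
    intro ω hω
    by_contra hω'
    rw [Set.mem_union, not_or, Set.mem_compl_iff, not_not] at hω'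
    refine hω ⟨hω'.1, rich_of_coinBlocks hn fun α hα β hβ i hi => ?_⟩
    by_contra hno
    push Not at hno
    refine hω'.2 (Set.mem_biUnion (x := (α, β, i)) ?_ fun b hb hall => ?_)
    · simp only [hI, Finset.coe_product, Finset.coe_range, Set.mem_prod, Set.mem_Iio]
      omega
    · obtain ⟨e, he, hne⟩ := hno b hb
      exact hne (hall e he)
  have hle : μ.real {ω | (∀ e, q e.dist = 0 → ω e = false) ∧
      Rich (Step (graphOfPairs ω) l) l n ρ K}ᶜ ≤
        (ρ + 1) * (ρ + 1) * (K + 1) * (1 - δ ^ (2 * ρ)) ^ N := by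
    refine (measureReal_mono hsub).trans ((measureReal_union_le _ _).trans ?_)
    rw [hcompat, zero_add]
    refine (measureReal_biUnion_finset_le _ _).trans
      ((Finset.sum_le_sum fun a _ => hbad a).trans ?_)
    rw [Finset.sum_const, hI, Finset.card_product, Finset.card_product, Finset.card_range,
      Finset.card_range, nsmul_eq_mul]
    push_cast
    exact (by ring : _ = _).le
  rw [probReal_compl_eq_one_sub (Set.toFinite _).measurableSet] at hle
  linarith

/-- The 0-1 law for a graph with a single distance, at which the edges are random. -/
theorem zeroOneLaw_of_single {q : ProbSeq} {l : ℕ+} (hl₀ : 0 < q l) (hl₁ : q l < 1)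
    (hq : ∀ i, i ≠ l → q i = 0) : ZeroOneLaw q := by
  have hl₀' : (0 : ℝ) < q l := hl₀
  have hl₁' : (q l : ℝ) < 1 := hl₁
  set δ : ℝ := min (q l : ℝ) (1 - q l)
  have hδ₀ : 0 < δ := lt_min hl₀' (by linarith)
  refine zeroOneLaw_of_backAndForth (fun r n => {ω | (∀ e, q e.dist = 0 → ω e = false) ∧
    Rich (Step (graphOfPairs ω) l) l n (2 ^ r) r}) (fun r => ?_) ?_
  · have hlim : Tendsto (fun N : ℕ => 1 - (((2 ^ r : ℕ) : ℝ) + 1) * (((2 ^ r : ℕ) : ℝ) + 1) *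
        (r + 1) * (1 - δ ^ (2 * 2 ^ r)) ^ N) atTop (𝓝 1) := by
      have h1 : δ ^ (2 * 2 ^ r) ≤ 1 :=
        pow_le_one₀ hδ₀.le ((min_le_left _ _).trans hl₁'.le)
      have := ((tendsto_pow_atTop_nhds_zero_of_lt_one (sub_nonneg.2 h1)
        (sub_lt_self 1 (pow_pos hδ₀ _))).const_mul
        ((((2 ^ r : ℕ) : ℝ) + 1) * (((2 ^ r : ℕ) : ℝ) + 1) * (r + 1))).const_sub 1
      simpa using this
    refine tendsto_order.2 ⟨fun a ha => ?_, fun a ha => Eventually.of_forall fun n =>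
      measureReal_le_one.trans_lt ha⟩
    obtain ⟨N, hN⟩ := (hlim.eventually (lt_mem_nhds ha)).exists
    filter_upwards [eventually_gt_atTop ((r + 1) * N * (2 * 2 ^ r + 1) * (l : ℕ))] with n hn
    exact hN.trans_le (one_sub_le_pairMeasure_rich hl₀ hl₁ hδ₀.le (min_le_left _ _)
      (min_le_right _ _) hn)
  · rintro r n m ω ⟨h₀, hrich⟩ ω' ⟨h₀', hrich'⟩
    have hadj : ∀ {n : ℕ} (ω : VertexPair n → Bool), (∀ e, q e.dist = 0 → ω e = false) →
        ∀ x y, (graphOfPairs ω).Adj x y → (y : ℤ) = x + (l : ℕ) ∨ (x : ℤ) = y + (l : ℕ) := by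
      intro n ω h₀ x y h
      obtain ⟨d, hd, hd'⟩ := exists_dist_of_adj h₀ h
      obtain rfl : d = l := by
        by_contra hdl
        exact hd (hq d hdl)
      exact_mod_cast hd'
    exact ⟨_, backAndForth_pathSim (by exact_mod_cast l.pos) (hadj ω h₀) (hadj ω' h₀') hrich hrich',
      fun x y => ⟨by omega, fun i => i.elim0, fun i => i.elim0⟩⟩

/-! ### Hereditary 0-1 laws -/

lemma unitInterval_eq_zero_or_one_or (c : unitInterval) : c = 0 ∨ c = 1 ∨ (0 < c ∧ c < 1) := by
  rcases eq_or_lt_of_le (unitInterval.nonneg' : 0 ≤ c) with h | h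
  · exact Or.inl h.symm
  · exact Or.inr (unitInterval.le_one'.eq_or_lt.imp_right fun h' => ⟨h, h'⟩)

theorem mainTheorem3 (p : ProbSeq) (hpos : 0 < (oneSet p).encard)
    (hfin : (oneSet p).encard < ⊤) :
    (HereditaryZeroOneLaw Gen2 p ↔ {l : ℕ+ | 0 < p l}.encard ≤ 1) ∧
    (HereditaryZeroOneLaw Gen3 p ↔ {l : ℕ+ | 0 < p l ∧ p l < 1} = ∅) ∧
    (1 < (oneSet p).encard →
      (HereditaryZeroOneLaw Gen1 p ↔ {l : ℕ+ | 0 < p l ∧ p l < 1} = ∅)) := by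
  classical
  have hfin' : (oneSet p).Finite := Set.encard_lt_top_iff.1 hfin
  obtain ⟨a, ha⟩ : (oneSet p).Nonempty := Set.encard_pos.1 hpos
  change p a = 1 at ha
  have hempty : {l : ℕ+ | 0 < p l ∧ p l < 1} = ∅ → ∀ l, p l = 0 ∨ p l = 1 := fun h l => by
    rcases unitInterval_eq_zero_or_one_or (p l) with h' | h' | h'
    · exact Or.inl h'
    · exact Or.inr h'
    · exact absurd h' (Set.eq_empty_iff_forall_notMem.1 h l)
  refine ⟨⟨fun h => ?_, fun h q hq => ?_⟩, ⟨fun h => ?_, fun h q hq => ?_⟩, fun hone =>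
    ⟨fun h => ?_, fun h q hq => ?_⟩⟩
  · -- Keep the value at `a`, decrease one other positive value below `1` and the rest to `0`.
    by_contra! hcard
    obtain ⟨b, hb, hba⟩ : ∃ b, 0 < p b ∧ b ≠ a := by
      obtain ⟨b, b', hb, hb', hne⟩ := Set.one_lt_encard_iff.1 hcard
      rcases eq_or_ne b a with rfl | hba
      · exact ⟨b', hb', hne.symm⟩
      · exact ⟨b, hb, hba⟩
    obtain ⟨c, hc₀, hc⟩ := exists_between hb
    refine not_zeroOneLaw_of_two_distances
      (q := fun l => if l = a then 1 else if l = b then c else 0)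
      (a := a) (b := b) (by simp) (by simpa [hba] using hc₀)
      (by simpa [hba] using hc.trans_le unitInterval.le_one')
      (fun l hla hlb => by simp [hla, hlb]) (h _ fun l => ?_)
    split_ifs with h1 h2
    · rw [h1, ha]
    · rw [h2]
      exact hc.le
    · exact unitInterval.nonneg'
  · have hq₀ : ∀ i, i ≠ a → q i = 0 := fun i hi => by
      by_contra hqi
      have hpi : 0 < p i := (lt_of_le_of_ne unitInterval.nonneg' (Ne.symm hqi)).trans_le (hq i)
      exact hi (Set.encard_le_one_iff.1 h i a hpi (by simp [ha]))
    have hqfin : (oneSet q).Finite := (Set.finite_singleton a).subset fun i hi => by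
      by_contra hia
      have : (0 : unitInterval) = 1 := (hq₀ i hia).symm.trans hi
      exact zero_ne_one this
    have hall : q a = 0 ∨ q a = 1 → ∀ i, q i = 0 ∨ q i = 1 := fun hqa i => by
      by_cases hia : i = a
      · exact hia ▸ hqa
      · exact Or.inl (hq₀ i hia)
    rcases unitInterval_eq_zero_or_one_or (q a) with hqa | hqa | ⟨h₀, h₁⟩
    · exact zeroOneLaw_of_finite (hall (Or.inl hqa)) hqfin
    · exact zeroOneLaw_of_finite (hall (Or.inr hqa)) hqfin
    · exact zeroOneLaw_of_single h₀ h₁ hq₀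
  · refine Set.eq_empty_iff_forall_notMem.2 fun b hb => ?_
    have hba : b ≠ a := fun hba => hb.2.ne (hba ▸ ha)
    refine not_zeroOneLaw_of_two_distances (q := fun l => if l = a ∨ l = b then p l else 0)
      (a := a) (b := b) (by simp [ha]) (by simpa using hb.1) (by simpa using hb.2)
      (fun l hla hlb => by simp [hla, hlb]) (h _ fun l => ?_)
    split_ifs
    · exact Or.inr rfl
    · exact Or.inl rfl
  · refine zeroOneLaw_of_finite (fun l => ?_) (hfin'.subset fun l hl => ?_)
    · exact (hq l).elim Or.inl fun hl => hl ▸ hempty h l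
    · exact ((hq l).resolve_left fun h0 => zero_ne_one (h0.symm.trans hl)).symm.trans hl
  · refine Set.eq_empty_iff_forall_notMem.2 fun c hc => ?_
    obtain ⟨u, v, hu, hv, huv⟩ : ∃ u v, p u = 1 ∧ p v = 1 ∧ u < v := by
      obtain ⟨u, v, hu, hv, hne⟩ := Set.one_lt_encard_iff.1 hone
      rcases lt_or_gt_of_ne hne with huv | huv
      · exact ⟨u, v, hu, hv, huv⟩
      · exact ⟨v, u, hv, hu, huv⟩
    obtain ⟨L, hL⟩ := hfin'.bddAbove
    have hmono := pnatSpread_strictMono (L := max L c) huv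
    set f := pnatSpread u v (max L c)
    set q : ProbSeq := Function.extend f p fun _ => 0
    have hqf : ∀ i, q (f i) = p i := fun i => hmono.injective.extend_apply p _ i
    have hq₀ : ∀ l, l ∉ Set.range f → q l = 0 := fun l hl => Function.extend_apply' p _ l hl
    exact not_zeroOneLaw_of_spread hfin' huv hu hv hc.1 hc.2 (le_max_right L c)
      (fun i hi => (hL hi).trans (le_max_left L c)) hqf hq₀ (h q ⟨f, hmono, hqf, hq₀⟩)
  · obtain ⟨f, -, hqf, hq₀⟩ := hq
    refine zeroOneLaw_of_finite (fun l => ?_) ((hfin'.image f).subset fun l hl => ?_)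
    · by_cases hl : l ∈ Set.range f
      · obtain ⟨i, rfl⟩ := hl
        rw [hqf]
        exact hempty h i
      · exact Or.inl (hq₀ l hl)
    · by_cases hl' : l ∈ Set.range f
      · obtain ⟨i, rfl⟩ := hl'
        exact ⟨i, (hqf i).symm.trans hl, rfl⟩
      · exact absurd ((hq₀ l hl').symm.trans hl) zero_ne_one
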